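/- Let $A,C\in\mathbb{R}^{n\times n}$, $B,D\in\mathbb{R}^{n\times m}$, $Q\in\mathbb{R}^{n\times n}$, $S\in\mathbb{R}^{m\times n}$, $R\in\mathbb{R}^{m\times m}$ and $\sigma\ge 0$, and suppose that $R$ and $Q-S'R^{-1}S$ are (symmetric) positive definite. Let $(w_t)_{t\ge 0}$ be independent Gaussian random variables with mean $0$ and variance $\sigma^2$, let $(\mathcal{F}_t)_{t\ge 0}$ be a filtration such that $w_t$ is $\mathcal{F}_{t+1}$-measurable and independent of $\mathcal{F}_t$ (for example $\mathcal{F}_t=\sigma(w_0,\dots,w_{t-1})$), write $\mathbb{E}_s=\mathbb{E}[\,\cdot\mid\mathcal{F}_s]$, and consider $$x_{t+1}=Ax_t+Bu_t+(Cx_t+Du_t)w_t .$$ A matrix $K\in\mathbb{R}^{m\times n}$ is a (mean-square) stabilizer if, for every deterministic $x_0$, the solution of $x_{t+1}=[(A+BK)+(C+DK)w_t]x_t$ satisfies $\lim_{t\to\infty}\mathbb{E}[x_t'x_t]=0$. For $s\ge 0$ and a deterministic $x_s=\xi\in\mathbb{R}^n$, a control $u=(u_t)_{t\ge s}$ is admissible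 if it is adapted, $\mathbb{E}\sum_{t\ge s}|u_t|^2<\infty$, and the state satisfies $\lim_{t\to\infty}\mathbb{E}|x_t|^2=0$; its cost is $$J(s,\xi;u)=\mathbb{E}_s\Big[\sum_{t=s}^\infty\big(x_t'Qx_t+2u_t'Sx_t+u_t'Ru_t\big)\Big]\in[0,\infty].$$ An admissible control $u^*$ is optimal if $J(s,\xi;u^*)\le J(s,\xi;u)$ almost surely for every admissible $u$. Let $K^{(0)}$ be a stabilizer and let $s,l\ge 0$ be integers. Policy iteration (Algorithm 1) generates $P^{(i+1)},K^{(i+1)}$, $i=0,1,2,\dots$, as follows. $P^{(i+1)}$ is a symmetric matrix such that, for every $\xi\in\mathbb{R}^n$, with $x^{(i)}$ the state on $[s,s+l+1]$ under $u=K^{(i)}x$ and $x^{(i)}_s=\xi$, almost surely $$\xi'P^{(i+1)}\xi-\mathbb{E}_s\big[(x^{(i)}_{s+l+1})'P^{(i+1)}x^{(i)}_{s+l+1}\big]=\mathbb{E}_s\Big[\sum_{t=s}^{s+l}(x^{(i)}_t)'\big(Q+(K^{(i)})'S+S'K^{(i)}+(K^{(i)})'RK^{(i)}\big)x^{(i)}_t\Big];$$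 and $K^{(i+1)}=\mathcal{K}(P^{(i+1)})$, where $$\mathcal{K}(P)=-(R+B'PB+\sigma^2D'PD)^{-1}(B'PA+\sigma^2D'PC+S).$$ Theorem 2. Sequences generated in this way exist, and every feedback control $u=Kx$ with a stabilizer $K$ is admissible, for every initial time and every initial state. For all sequences generated in this way, the matrices $P^{(i)}$, $i\ge 1$, are positive definite and monotonically decreasing ($P^{(i)}-P^{(i+1)}$ is positive semidefinite). They converge to a matrix $P$, which is the unique positive definite solution of the stochastic algebraic Riccati equation $$P=Q+A'PA+\sigma^2C'PC-(B'PA+\sigma^2D'PC+S)'(R+B'PB+\sigma^2D'PD)^{-1}(B'PA+\sigma^2D'PC+S).$$ The gains $K^{(i)}$ converge to $K=\mathcal{K}(P)$, and $K$ is a stabilizer. For every initial time $s\ge 0$ and every initial state $\xi$, the feedback control $u^*=Kx^*$ is optimal, and it is the only optimal control (up to almost sure equality at each time). -/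

import Mathlib

open MeasureTheory ProbabilityTheory Filter Topology Matrix
open scoped NNReal ENNReal

namespace StochLQ

/-- The data of the problem: the dynamics `x_{t+1} = A x_t + B u_t + (C x_t + D u_t) w_t`, the
weights of the running cost `x' Q x + 2 u' S x + u' R u`, and the standard deviation `σ` of the
scalar noise `w_t`. -/
structure Data (n m : ℕ) where
  A : Matrix (Fin n) (Fin n) ℝ
  C : Matrix (Fin n) (Fin n) ℝ
  B : Matrix (Fin n) (Fin m) ℝ
  D : Matrix (Fin n) (Fin m) ℝ
  Q : Matrix (Fin n) (Fin n) ℝ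
  S : Matrix (Fin m) (Fin n) ℝ
  R : Matrix (Fin m) (Fin m) ℝ
  σ : ℝ≥0

/-- `w` is a centred Gaussian white noise of variance `σ ^ 2` with respect to the filtration `ℱ`:
`w t` is revealed at time `t + 1` and is independent of the information `ℱ t` available at time
`t`. For an independent Gaussian sequence, this holds with `ℱ t = σ(w 0, …, w (t - 1))`. -/
structure IsGaussianNoise {Ω : Type*} {mΩ : MeasurableSpace Ω} (μ : Measure Ω)
    (ℱ : Filtration ℕ mΩ) (w : ℕ → Ω → ℝ) (σ : ℝ≥0) : Prop where
  law : ∀ t, HasLaw (w t) (gaussianReal 0 (σ ^ 2)) μ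
  adapted : ∀ t, Measurable[ℱ (t + 1)] (w t)
  indep : ∀ t, Indep (MeasurableSpace.comap (w t) inferInstance) (ℱ t) μ

/-- The autonomous system `x_{t+1} = (F + w_t G) x_t` started from `x_s = ξ`; the value at `k` is
`x_{s+k}`. -/
def autState {n : ℕ} {Ω : Type*} (w : ℕ → Ω → ℝ) (F G : Matrix (Fin n) (Fin n) ℝ)
    (s : ℕ) (ξ : Fin n → ℝ) : ℕ → Ω → Fin n → ℝ
  | 0, _ => ξ
  | k + 1, ω => (F + w (s + k) ω • G) *ᵥ autState w F G s ξ k ω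

/-- Asymptotic mean-square stability of `x_{t+1} = (F + w_t G) x_t`. -/
def IsMeanSquareStable {n : ℕ} {Ω : Type*} {mΩ : MeasurableSpace Ω} (μ : Measure Ω)
    (w : ℕ → Ω → ℝ) (F G : Matrix (Fin n) (Fin n) ℝ) : Prop :=
  ∀ ξ : Fin n → ℝ, Tendsto
    (fun t => ∫ ω, autState w F G 0 ξ t ω ⬝ᵥ autState w F G 0 ξ t ω ∂μ) atTop (𝓝 0)

namespace Data

variable {n m : ℕ} (sys : Data n m) {Ω : Type*} {mΩ : MeasurableSpace Ω}

/-- The set of gains `K` for which the closed loop under `u = K x` is mean-square stable. -/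
def stabilizers (μ : Measure Ω) (w : ℕ → Ω → ℝ) : Set (Matrix (Fin m) (Fin n) ℝ) :=
  {K | IsMeanSquareStable μ w (sys.A + sys.B * K) (sys.C + sys.D * K)}

/-- The state started from `x_s = ξ` under a control on `[s, ∞)`. Time is counted from `s`: `u k`
is the control `u_{s+k}` and the value at `k` is `x_{s+k}`. -/
def state (w : ℕ → Ω → ℝ) (s : ℕ) (ξ : Fin n → ℝ) (u : ℕ → Ω → Fin m → ℝ) :
    ℕ → Ω → Fin n → ℝ
  | 0, _ => ξ
  | k + 1, ω =>
      sys.A *ᵥ state w s ξ u k ω + sys.B *ᵥ u k ω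
        + w (s + k) ω • (sys.C *ᵥ state w s ξ u k ω + sys.D *ᵥ u k ω)

/-- The closed-loop state under the gain `K`, started from `x_s = ξ`. -/
def closedLoop (w : ℕ → Ω → ℝ) (K : Matrix (Fin m) (Fin n) ℝ) (s : ℕ) (ξ : Fin n → ℝ) :
    ℕ → Ω → Fin n → ℝ :=
  autState w (sys.A + sys.B * K) (sys.C + sys.D * K) s ξ

/-- The feedback control `u = K x`, as a process on `[s, ∞)`. -/
def feedback (w : ℕ → Ω → ℝ) (K : Matrix (Fin m) (Fin n) ℝ) (s : ℕ) (ξ : Fin n → ℝ) :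
    ℕ → Ω → Fin m → ℝ :=
  fun k ω => K *ᵥ sys.closedLoop w K s ξ k ω

/-- The state driven by the feedback control is the closed-loop state. -/
theorem state_feedback (w : ℕ → Ω → ℝ) (K : Matrix (Fin m) (Fin n) ℝ) (s : ℕ) (ξ : Fin n → ℝ)
    (k : ℕ) (ω : Ω) :
    sys.state w s ξ (sys.feedback w K s ξ) k ω = sys.closedLoop w K s ξ k ω := by
  induction k with
  | zero => rfl
  | succ k ih =>
    simp only [state, ih, feedback, closedLoop, autState, Matrix.add_mulVec, Matrix.smul_mulVec,
      Matrix.mulVec_mulVec]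

/-- Admissible controls for the initial pair `(s, ξ)`: adapted, square integrable on `[s, ∞)`, and
stabilizing, i.e. the controlled state tends to `0` in mean square. -/
structure IsAdmissible (μ : Measure Ω) (ℱ : Filtration ℕ mΩ) (w : ℕ → Ω → ℝ) (s : ℕ)
    (ξ : Fin n → ℝ) (u : ℕ → Ω → Fin m → ℝ) : Prop where
  adapted : ∀ k, Measurable[ℱ (s + k)] (u k)
  sq_integrable : ∑' k, ∫⁻ ω, ENNReal.ofReal (u k ω ⬝ᵥ u k ω) ∂μ < ∞
  stabilizing : Tendsto
    (fun k => ∫⁻ ω, ENNReal.ofReal (sys.state w s ξ u k ω ⬝ᵥ sys.state w s ξ u k ω) ∂μ)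
    atTop (𝓝 0)

/-- The running cost `x' Q x + 2 u' S x + u' R u`. -/
def runningCost (x : Fin n → ℝ) (u : Fin m → ℝ) : ℝ :=
  x ⬝ᵥ sys.Q *ᵥ x + 2 * (u ⬝ᵥ sys.S *ᵥ x) + u ⬝ᵥ sys.R *ᵥ u

/-- Standing assumption on the weights: `R > 0` and `Q - S' R⁻¹ S > 0`. It makes the running cost
nonnegative. -/
def WeightsPosDef : Prop :=
  sys.R.PosDef ∧ (sys.Q - sys.Sᵀ * sys.R⁻¹ * sys.S).PosDef

/-- The cost `J(s, ξ; u) = E_s [∑_{t ≥ s} x_t' Q x_t + 2 u_t' S x_t + u_t' R u_t]`, where `E_s` is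
the conditional expectation given `ℱ s`. The running cost is nonnegative under `WeightsPosDef`, so
the series is taken in `[0, ∞]`. -/
noncomputable def cost (μ : Measure Ω) (ℱ : Filtration ℕ mΩ) (w : ℕ → Ω → ℝ) (s : ℕ)
    (ξ : Fin n → ℝ) (u : ℕ → Ω → Fin m → ℝ) : Ω → ℝ≥0∞ :=
  condLExp (ℱ s) μ
    (fun ω => ∑' k, ENNReal.ofReal (sys.runningCost (sys.state w s ξ u k ω) (u k ω)))

/-- `u` solves the infinite-horizon problem for the initial pair `(s, ξ)`. -/
def IsOptimal (μ : Measure Ω) (ℱ : Filtration ℕ mΩ) (w : ℕ → Ω → ℝ) (s : ℕ)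
    (ξ : Fin n → ℝ) (u : ℕ → Ω → Fin m → ℝ) : Prop :=
  sys.IsAdmissible μ ℱ w s ξ u ∧
    ∀ v, sys.IsAdmissible μ ℱ w s ξ v → sys.cost μ ℱ w s ξ u ≤ᵐ[μ] sys.cost μ ℱ w s ξ v

/-- The improved gain `-(R + B'PB + σ² D'PD)⁻¹ (B'PA + σ² D'PC + S)`. -/
noncomputable def gain (P : Matrix (Fin n) (Fin n) ℝ) : Matrix (Fin m) (Fin n) ℝ :=
  -((sys.R + sys.Bᵀ * P * sys.B + (sys.σ : ℝ) ^ 2 • (sys.Dᵀ * P * sys.D))⁻¹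
    * (sys.Bᵀ * P * sys.A + (sys.σ : ℝ) ^ 2 • (sys.Dᵀ * P * sys.C) + sys.S))

/-- The stochastic algebraic Riccati equation. -/
def SolvesSARE (P : Matrix (Fin n) (Fin n) ℝ) : Prop :=
  P = sys.Q + sys.Aᵀ * P * sys.A + (sys.σ : ℝ) ^ 2 • (sys.Cᵀ * P * sys.C)
    - (sys.Bᵀ * P * sys.A + (sys.σ : ℝ) ^ 2 • (sys.Dᵀ * P * sys.C) + sys.S)ᵀ
      * (sys.R + sys.Bᵀ * P * sys.B + (sys.σ : ℝ) ^ 2 • (sys.Dᵀ * P * sys.D))⁻¹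
      * (sys.Bᵀ * P * sys.A + (sys.σ : ℝ) ^ 2 • (sys.Dᵀ * P * sys.C) + sys.S)

/-- Policy evaluation of the gain `K` from trajectories on `[s, s + l + 1]`: for every initial
state `ξ`, with `x` the closed-loop state under `K` from `x_s = ξ`, almost surely
`ξ'Pξ - E_s[x_{s+l+1}' P x_{s+l+1}] = E_s[∑_{t=s}^{s+l} x_t' (Q + K'S + S'K + K'RK) x_t]`. -/
def PolicyEvaluation (μ : Measure Ω) (ℱ : Filtration ℕ mΩ) (w : ℕ → Ω → ℝ) (s l : ℕ)
    (K : Matrix (Fin m) (Fin n) ℝ) (P : Matrix (Fin n) (Fin n) ℝ) : Prop :=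
  ∀ ξ : Fin n → ℝ,
    (fun ω => ξ ⬝ᵥ P *ᵥ ξ
      - (μ[fun ω' => sys.closedLoop w K s ξ (l + 1) ω' ⬝ᵥ
          P *ᵥ sys.closedLoop w K s ξ (l + 1) ω' | ℱ s]) ω)
    =ᵐ[μ]
    μ[fun ω => ∑ k ∈ Finset.range (l + 1), sys.closedLoop w K s ξ k ω ⬝ᵥ
        (sys.Q + Kᵀ * sys.S + sys.Sᵀ * K + Kᵀ * sys.R * K) *ᵥ sys.closedLoop w K s ξ k ω | ℱ s]

/-- `P` and `K` are generated by policy iteration from the initial gain `K₀`, with trajectories on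
`[s, s + l + 1]`: for every `i`, `P (i + 1)` is a symmetric solution of policy evaluation for
`K i`, and `K (i + 1)` is the gain of `P (i + 1)`. The value `P 0` plays no role. -/
structure IsPolicyIteration (μ : Measure Ω) (ℱ : Filtration ℕ mΩ) (w : ℕ → Ω → ℝ) (s l : ℕ)
    (K₀ : Matrix (Fin m) (Fin n) ℝ) (P : ℕ → Matrix (Fin n) (Fin n) ℝ)
    (K : ℕ → Matrix (Fin m) (Fin n) ℝ) : Prop where
  init : K 0 = K₀
  symm : ∀ i, (P (i + 1)).IsSymm
  evaluation : ∀ i, sys.PolicyEvaluation μ ℱ w s l (K i) (P (i + 1))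
  improvement : ∀ i, K (i + 1) = sys.gain (P (i + 1))

end Data

end StochLQ

/-! Of the noise, only mean zero, variance `σ ^ 2` and independence from the past are used.
Conditional second moments therefore evolve linearly: `E_s[x_{s+k}' X x_{s+k}] = ξ' L^k(X) ξ` with
`L X = F' X F + σ² G' X G` (`IsGaussianNoise.setIntegral_autState`). Mean-square stability becomes
`L^k 1 → 0`, and for a stabilizing gain policy evaluation is equivalent to the Lyapunov equation `P
- L P = M`, whatever `s` and `l` are (`IsStabilizingGain.policyEvaluation_iff`). The algorithm is
thus exact policy iteration on matrices.

Everything else rests on completing the square: running cost plus expected next value equals `x'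
Ric(P) x` plus a nonnegative excess that vanishes at `u = 𝒦(P) x` (`runningCost_add_expectedValue`).
The value `P` of a stabilizing gain hence satisfies `P ≥ Ric(P)`, which makes `P` a Lyapunov
function for `𝒦(P)` and bounds the next value by `P`. Values decrease and stay above `Q - S' R⁻¹ S >
0`, so they converge to a positive definite solution of the Riccati equation
(`exists_tendsto_of_isValue`). Two such solutions lie below each other by comparison, hence
coincide.

Summing the same identity along an admissible control, whose terminal value vanishes, shows that its
cost is `ξ' P ξ` plus the conditional expectation of the total excess (`IsAdmissible.cost_ae_eq`).
Zero excess at all times characterizes the feedback control, which gives optimality and uniqueness.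
-/

namespace StochLQ

/-! ### Quadratic forms of real matrices -/

section QuadraticForms

variable {n : ℕ}

theorem dotProduct_mulVec_comm {X : Matrix (Fin n) (Fin n) ℝ} (hX : X.IsSymm) (x y : Fin n → ℝ) :
    x ⬝ᵥ X *ᵥ y = y ⬝ᵥ X *ᵥ x := by
  rw [dotProduct_comm, dotProduct_mulVec, ← mulVec_transpose, hX.eq, dotProduct_comm]

theorem dotProduct_mulVec_add_self {X : Matrix (Fin n) (Fin n) ℝ} (hX : X.IsSymm)
    (x y : Fin n → ℝ) :
    (x + y) ⬝ᵥ X *ᵥ (x + y) = x ⬝ᵥ X *ᵥ x + 2 * (x ⬝ᵥ X *ᵥ y) + y ⬝ᵥ X *ᵥ y := by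
  simp only [mulVec_add, add_dotProduct, dotProduct_add, dotProduct_mulVec_comm hX y x]
  ring

theorem dotProduct_mulVec_conj {k p q : ℕ} (F : Matrix (Fin k) (Fin p) ℝ)
    (P : Matrix (Fin k) (Fin k) ℝ) (G : Matrix (Fin k) (Fin q) ℝ) (x : Fin p → ℝ)
    (y : Fin q → ℝ) : x ⬝ᵥ (Fᵀ * P * G) *ᵥ y = (F *ᵥ x) ⬝ᵥ P *ᵥ (G *ᵥ y) := by
  rw [← mulVec_mulVec, ← mulVec_mulVec, dotProduct_mulVec, vecMul_transpose]

/-- Polarization: the entries of a symmetric matrix in terms of its quadratic form. -/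
theorem apply_eq_of_isSymm {X : Matrix (Fin n) (Fin n) ℝ} (hX : X.IsSymm) (i j : Fin n) :
    X i j = ((Pi.single i 1 + Pi.single j 1) ⬝ᵥ X *ᵥ (Pi.single i 1 + Pi.single j 1)
      - Pi.single i 1 ⬝ᵥ X *ᵥ Pi.single i 1 - Pi.single j 1 ⬝ᵥ X *ᵥ Pi.single j 1) / 2 := by
  rw [dotProduct_mulVec_add_self hX]
  simp only [single_dotProduct, mulVec_single_one, col_apply, one_mul]
  ring

theorem eq_of_dotProduct_mulVec_eq {X Y : Matrix (Fin n) (Fin n) ℝ} (hX : X.IsSymm)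
    (hY : Y.IsSymm) (h : ∀ x, x ⬝ᵥ X *ᵥ x = x ⬝ᵥ Y *ᵥ x) : X = Y := by
  ext i j
  rw [apply_eq_of_isSymm hX, apply_eq_of_isSymm hY, h, h, h]

/-- By polarization each entry is a fixed combination of three values of the form. This turns
monotone convergence of scalars into convergence of matrices. -/
theorem exists_tendsto_of_dotProduct_mulVec {X : ℕ → Matrix (Fin n) (Fin n) ℝ}
    (hX : ∀ k, (X k).IsSymm)
    (h : ∀ x, ∃ c, Tendsto (fun k => x ⬝ᵥ X k *ᵥ x) atTop (𝓝 c)) :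
    ∃ Y : Matrix (Fin n) (Fin n) ℝ, Tendsto X atTop (𝓝 Y) := by
  choose c hc using h
  refine ⟨fun i j => (c (Pi.single i 1 + Pi.single j 1) - c (Pi.single i 1)
    - c (Pi.single j 1)) / 2, ?_⟩
  refine tendsto_pi_nhds.2 fun i => tendsto_pi_nhds.2 fun j => ?_
  simp only [fun k => apply_eq_of_isSymm (hX k) i j]
  exact (((hc _).sub (hc _)).sub (hc _)).div_const 2

theorem tendsto_dotProduct_mulVec {X : ℕ → Matrix (Fin n) (Fin n) ℝ}
    {Y : Matrix (Fin n) (Fin n) ℝ} (h : Tendsto X atTop (𝓝 Y)) (x : Fin n → ℝ) :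
    Tendsto (fun k => x ⬝ᵥ X k *ᵥ x) atTop (𝓝 (x ⬝ᵥ Y *ᵥ x)) :=
  ((by fun_prop : Continuous fun Z : Matrix (Fin n) (Fin n) ℝ => x ⬝ᵥ Z *ᵥ x).tendsto Y).comp h

theorem isSymm_of_tendsto {X : ℕ → Matrix (Fin n) (Fin n) ℝ} {Y : Matrix (Fin n) (Fin n) ℝ}
    (hX : ∀ k, (X k).IsSymm) (h : Tendsto X atTop (𝓝 Y)) : Y.IsSymm := by
  have h' : Tendsto (fun k => (X k)ᵀ) atTop (𝓝 Yᵀ) :=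
    ((by fun_prop : Continuous fun Z : Matrix (Fin n) (Fin n) ℝ => Zᵀ).tendsto Y).comp h
  simp only [fun k => (hX k).eq] at h'
  exact tendsto_nhds_unique h' h

theorem posSemidef_of_isSymm {X : Matrix (Fin n) (Fin n) ℝ} (hX : X.IsSymm)
    (h : ∀ x, 0 ≤ x ⬝ᵥ X *ᵥ x) : X.PosSemidef :=
  .of_dotProduct_mulVec_nonneg (by rwa [IsHermitian, conjTranspose_eq_transpose_of_trivial])
    (by simpa using h)

theorem posDef_of_isSymm {X : Matrix (Fin n) (Fin n) ℝ} (hX : X.IsSymm)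
    (h : ∀ x, x ≠ 0 → 0 < x ⬝ᵥ X *ᵥ x) : X.PosDef :=
  .of_dotProduct_mulVec_pos (by rwa [IsHermitian, conjTranspose_eq_transpose_of_trivial])
    (by simpa using h)

theorem isSymm_of_posDef {X : Matrix (Fin n) (Fin n) ℝ} (hX : X.PosDef) : X.IsSymm := by
  have h := hX.isHermitian
  rwa [IsHermitian, conjTranspose_eq_transpose_of_trivial] at h

theorem dotProduct_mulVec_pos {X : Matrix (Fin n) (Fin n) ℝ} (hX : X.PosDef) {x : Fin n → ℝ}
    (hx : x ≠ 0) : 0 < x ⬝ᵥ X *ᵥ x := by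
  simpa using hX.dotProduct_mulVec_pos hx

theorem dotProduct_mulVec_nonneg {X : Matrix (Fin n) (Fin n) ℝ} (hX : X.PosDef) (x : Fin n → ℝ) :
    0 ≤ x ⬝ᵥ X *ᵥ x := by
  simpa using hX.posSemidef.dotProduct_mulVec_nonneg x

theorem eq_zero_of_dotProduct_mulVec {X : Matrix (Fin n) (Fin n) ℝ} (hX : X.PosDef)
    {x : Fin n → ℝ} (hx : x ⬝ᵥ X *ᵥ x = 0) : x = 0 := by
  by_contra h
  exact (dotProduct_mulVec_pos hX h).ne' hx

theorem sq_le_dotProduct_self (x : Fin n → ℝ) (i : Fin n) : x i ^ 2 ≤ x ⬝ᵥ x := by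
  rw [sq]
  exact Finset.single_le_sum (f := fun j => x j * x j) (fun j _ => mul_self_nonneg _)
    (Finset.mem_univ i)

theorem exists_abs_dotProduct_mulVec_le (X : Matrix (Fin n) (Fin n) ℝ) :
    ∃ c : ℝ, ∀ x, |x ⬝ᵥ X *ᵥ x| ≤ c * (x ⬝ᵥ x) := by
  refine ⟨∑ i, ∑ j, |X i j|, fun x => ?_⟩
  have hX : x ⬝ᵥ X *ᵥ x = ∑ i, ∑ j, X i j * (x i * x j) := by
    simp only [dotProduct, mulVec, Finset.mul_sum]
    exact Finset.sum_congr rfl fun i _ => Finset.sum_congr rfl fun j _ => by ring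
  rw [hX, Finset.sum_mul]
  refine (Finset.abs_sum_le_sum_abs _ _).trans (Finset.sum_le_sum fun i _ => ?_)
  rw [Finset.sum_mul]
  refine (Finset.abs_sum_le_sum_abs _ _).trans (Finset.sum_le_sum fun j _ => ?_)
  rw [abs_mul, abs_mul]
  refine mul_le_mul_of_nonneg_left ?_ (abs_nonneg _)
  have hi := sq_le_dotProduct_self x i
  have hj := sq_le_dotProduct_self x j
  -- `|x i| |x j| ≤ (x i ^ 2 + x j ^ 2) / 2 ≤ x ⬝ᵥ x`.
  nlinarith [sq_nonneg (|x i| - |x j|), sq_abs (x i), sq_abs (x j)]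

/-- The quotient of the two forms is homogeneous of degree zero and bounded on the compact unit
sphere. The sphere is that of the sup norm, which is harmless since only scaling is used. -/
theorem exists_dotProduct_self_le {X : Matrix (Fin n) (Fin n) ℝ} (hX : X.PosDef) :
    ∃ c : ℝ, ∀ x, x ⬝ᵥ x ≤ c * (x ⬝ᵥ X *ᵥ x) := by
  have hcont : ContinuousOn (fun x : Fin n → ℝ => x ⬝ᵥ x / (x ⬝ᵥ X *ᵥ x))
      (Metric.sphere 0 1) :=
    ContinuousOn.div (by fun_prop) (by fun_prop) fun x hx =>
      (dotProduct_mulVec_pos hX (ne_zero_of_mem_unit_sphere ⟨x, hx⟩)).ne'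
  obtain ⟨c, hc⟩ := (isCompact_sphere (0 : Fin n → ℝ) 1).bddAbove_image hcont
  refine ⟨c, fun x => ?_⟩
  rcases eq_or_ne x 0 with rfl | hx
  · simp
  have hmem : ‖x‖⁻¹ • x ∈ Metric.sphere (0 : Fin n → ℝ) 1 := by
    simp [norm_smul, norm_ne_zero_iff.2 hx]
  have hquot := hc (Set.mem_image_of_mem _ hmem)
  have hr : ‖x‖⁻¹ * ‖x‖⁻¹ ≠ 0 := by simp [norm_ne_zero_iff.2 hx]
  simp only [mulVec_smul, smul_dotProduct, dotProduct_smul, smul_eq_mul, ← mul_assoc] at hquot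
  rw [mul_div_mul_left _ _ hr, div_le_iff₀ (dotProduct_mulVec_pos hX hx)] at hquot
  exact hquot

end QuadraticForms

/-! ### Lyapunov operators and stability of second moments -/

section Lyapunov

variable {n : ℕ}

/-- The Lyapunov operator `X ↦ F' X F + v G' X G`, the adjoint of the second-moment dynamics of
`x_{t+1} = (F + w_t G) x_t` for a white noise `w` of variance `v`. -/
def lyapunov (v : ℝ) (F G : Matrix (Fin n) (Fin n) ℝ) :
    Module.End ℝ (Matrix (Fin n) (Fin n) ℝ) where
  toFun X := Fᵀ * X * F + v • (Gᵀ * X * G)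
  map_add' X Y := by simp only [mul_add, add_mul, smul_add]; abel
  map_smul' c X := by simp [smul_comm v c]

variable {v : ℝ} {F G : Matrix (Fin n) (Fin n) ℝ}

theorem dotProduct_lyapunov_mulVec (X : Matrix (Fin n) (Fin n) ℝ) (x : Fin n → ℝ) :
    x ⬝ᵥ lyapunov v F G X *ᵥ x
      = (F *ᵥ x) ⬝ᵥ X *ᵥ (F *ᵥ x) + v * ((G *ᵥ x) ⬝ᵥ X *ᵥ (G *ᵥ x)) := by
  simp [lyapunov, add_mulVec, smul_mulVec, dotProduct_mulVec_conj]

theorem lyapunov_isSymm {X : Matrix (Fin n) (Fin n) ℝ} (hX : X.IsSymm) :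
    (lyapunov v F G X).IsSymm := by
  simp [lyapunov, Matrix.IsSymm, transpose_add, transpose_smul, transpose_mul, hX.eq, Matrix.mul_assoc]

theorem lyapunov_pow_isSymm {X : Matrix (Fin n) (Fin n) ℝ} (hX : X.IsSymm) (k : ℕ) :
    ((lyapunov v F G ^ k) X).IsSymm := by
  induction k with
  | zero => simpa using hX
  | succ k ih => rw [pow_succ', Module.End.mul_apply]; exact lyapunov_isSymm ih

theorem dotProduct_lyapunov_pow_mulVec_nonneg (hv : 0 ≤ v) {X : Matrix (Fin n) (Fin n) ℝ}
    (hX : ∀ x, 0 ≤ x ⬝ᵥ X *ᵥ x) (k : ℕ) (x : Fin n → ℝ) :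
    0 ≤ x ⬝ᵥ (lyapunov v F G ^ k) X *ᵥ x := by
  induction k generalizing x with
  | zero => simpa using hX x
  | succ k ih =>
    rw [pow_succ', Module.End.mul_apply, dotProduct_lyapunov_mulVec]
    exact add_nonneg (ih _) (mul_nonneg hv (ih _))

theorem dotProduct_lyapunov_pow_mulVec_mono (hv : 0 ≤ v) {X Y : Matrix (Fin n) (Fin n) ℝ}
    (h : ∀ x, x ⬝ᵥ X *ᵥ x ≤ x ⬝ᵥ Y *ᵥ x) (k : ℕ) (x : Fin n → ℝ) :
    x ⬝ᵥ (lyapunov v F G ^ k) X *ᵥ x ≤ x ⬝ᵥ (lyapunov v F G ^ k) Y *ᵥ x := by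
  have := dotProduct_lyapunov_pow_mulVec_nonneg (F := F) (G := G) hv (X := Y - X)
    (fun x => by simpa [sub_mulVec] using h x) k x
  simpa [map_sub, sub_mulVec] using this

/-- The algebraic form of mean-square stability: the second moments of
`x_{t+1} = (F + w_t G) x_t` tend to `0`. -/
def IsStablePair (v : ℝ) (F G : Matrix (Fin n) (Fin n) ℝ) : Prop :=
  ∀ x : Fin n → ℝ, Tendsto (fun k => x ⬝ᵥ (lyapunov v F G ^ k) 1 *ᵥ x) atTop (𝓝 0)

/-- Sandwich `X` between `-c • 1` and `c • 1`; powers of the Lyapunov operator preserve the order.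
-/
theorem IsStablePair.tendsto (h : IsStablePair v F G) (hv : 0 ≤ v)
    (X : Matrix (Fin n) (Fin n) ℝ) (x : Fin n → ℝ) :
    Tendsto (fun k => x ⬝ᵥ (lyapunov v F G ^ k) X *ᵥ x) atTop (𝓝 0) := by
  obtain ⟨c, hc⟩ := exists_abs_dotProduct_mulVec_le X
  have hsmul : ∀ (a : ℝ) (k : ℕ), x ⬝ᵥ (lyapunov v F G ^ k) (a • 1) *ᵥ x
      = a * (x ⬝ᵥ (lyapunov v F G ^ k) 1 *ᵥ x) := fun a k => by simp [smul_mulVec]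
  have hlim : ∀ a : ℝ, Tendsto (fun k => x ⬝ᵥ (lyapunov v F G ^ k) (a • 1) *ᵥ x)
      atTop (𝓝 0) := fun a => by
    simp only [hsmul]
    simpa using (h x).const_mul a
  refine tendsto_of_tendsto_of_tendsto_of_le_of_le (hlim (-c)) (hlim c) (fun k => ?_) fun k => ?_
  · refine dotProduct_lyapunov_pow_mulVec_mono hv (fun y => ?_) k x
    simpa [neg_mulVec, smul_mulVec] using neg_le_of_abs_le (hc y)
  · refine dotProduct_lyapunov_pow_mulVec_mono hv (fun y => ?_) k x
    simpa [smul_mulVec] using le_of_abs_le (hc y)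

theorem sub_lyapunov_pow {P M : Matrix (Fin n) (Fin n) ℝ} (h : P - lyapunov v F G P = M) (k : ℕ) :
    P - (lyapunov v F G ^ k) P = ∑ i ∈ Finset.range k, (lyapunov v F G ^ i) M := by
  induction k with
  | zero => simp
  | succ k ih =>
    rw [Finset.sum_range_succ, ← ih, ← h, map_sub, pow_succ, Module.End.mul_apply]
    abel

/-- A fixed point of the power `k + 1` is fixed along all multiples of `k + 1`, while its form tends
to zero. The one-step equation needs `k = 0`; policy evaluation over `l + 1` steps needs `k = l`. -/
theorem IsStablePair.eq_zero (h : IsStablePair v F G) (hv : 0 ≤ v) {X : Matrix (Fin n) (Fin n) ℝ}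
    (hX : X.IsSymm) {k : ℕ} (hk : (lyapunov v F G ^ (k + 1)) X = X) : X = 0 := by
  have hfix : ∀ j : ℕ, (lyapunov v F G ^ ((k + 1) * j)) X = X := fun j => by
    induction j with
    | zero => simp
    | succ j ih => rw [mul_add_one, pow_add, Module.End.mul_apply, hk, ih]
  refine eq_of_dotProduct_mulVec_eq hX isSymm_zero fun x => ?_
  have ht : Tendsto (fun j => (k + 1) * j) atTop atTop :=
    tendsto_id.const_mul_atTop' (Nat.succ_pos k)
  have := (h.tendsto hv X x).comp ht
  simp only [Function.comp_def, hfix] at this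
  simpa using tendsto_nhds_unique tendsto_const_nhds this

/-- In finite dimension uniqueness gives existence. The operator is restricted to symmetric matrices
because `IsStablePair.eq_zero` only sees quadratic forms. -/
theorem IsStablePair.exists_sub_lyapunov_eq (h : IsStablePair v F G) (hv : 0 ≤ v)
    {M : Matrix (Fin n) (Fin n) ℝ} (hM : M.IsSymm) :
    ∃ P : Matrix (Fin n) (Fin n) ℝ, P.IsSymm ∧ P - lyapunov v F G P = M := by
  let V : Submodule ℝ (Matrix (Fin n) (Fin n) ℝ) :=
    { carrier := {X | X.IsSymm}
      add_mem' := fun hX hY => hX.add hY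
      zero_mem' := isSymm_zero
      smul_mem' := fun c X hX => hX.smul c }
  let T : V →ₗ[ℝ] V := (1 - lyapunov v F G).restrict
    (fun X (hX : X.IsSymm) => show (X - lyapunov v F G X).IsSymm from hX.sub (lyapunov_isSymm hX))
  have hinj : Function.Injective T := by
    refine (injective_iff_map_eq_zero T).2 fun X hX => ?_
    have h0 : (X : Matrix (Fin n) (Fin n) ℝ) - lyapunov v F G X = 0 := congrArg Subtype.val hX
    exact Subtype.ext (h.eq_zero hv X.2 (k := 0) (by simpa using (sub_eq_zero.1 h0).symm))
  obtain ⟨P, hP⟩ := LinearMap.injective_iff_surjective.1 hinj ⟨M, hM⟩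
  exact ⟨P, P.2, congrArg Subtype.val hP⟩

/-- `P - L^k P` is a sum of nonnegative forms and `L^k P → 0`, so `P ≥ 0`; then `P = M + L P ≥ M`.
-/
theorem IsStablePair.le_dotProduct_mulVec (h : IsStablePair v F G) (hv : 0 ≤ v)
    {P M : Matrix (Fin n) (Fin n) ℝ} (hP : P - lyapunov v F G P = M)
    (hM : ∀ x, 0 ≤ x ⬝ᵥ M *ᵥ x) (x : Fin n → ℝ) : x ⬝ᵥ M *ᵥ x ≤ x ⬝ᵥ P *ᵥ x := by
  have hnonneg : ∀ x, 0 ≤ x ⬝ᵥ P *ᵥ x := fun x => by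
    refine ge_of_tendsto' ((tendsto_const_nhds (x := x ⬝ᵥ P *ᵥ x)).sub (h.tendsto hv P x))
      (fun k => ?_) |>.trans_eq (sub_zero _)
    rw [← dotProduct_sub, ← sub_mulVec, sub_lyapunov_pow hP, sum_mulVec, dotProduct_sum]
    exact Finset.sum_nonneg fun i _ => dotProduct_lyapunov_pow_mulVec_nonneg hv hM i x
  have := dotProduct_lyapunov_pow_mulVec_nonneg (F := F) (G := G) hv hnonneg 1 x
  rw [pow_one] at this
  rw [← hP, sub_mulVec, dotProduct_sub]
  linarith

theorem summable_lyapunov_pow (hv : 0 ≤ v) {P M : Matrix (Fin n) (Fin n) ℝ}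
    (hP : P - lyapunov v F G P = M) (hM : ∀ x, 0 ≤ x ⬝ᵥ M *ᵥ x)
    (hnonneg : ∀ x, 0 ≤ x ⬝ᵥ P *ᵥ x) (x : Fin n → ℝ) :
    Summable fun k => x ⬝ᵥ (lyapunov v F G ^ k) M *ᵥ x := by
  refine summable_of_sum_range_le (c := x ⬝ᵥ P *ᵥ x)
    (fun k => dotProduct_lyapunov_pow_mulVec_nonneg hv hM k x) fun k => ?_
  rw [← dotProduct_sum, ← sum_mulVec, ← sub_lyapunov_pow hP, sub_mulVec, dotProduct_sub]
  linarith [dotProduct_lyapunov_pow_mulVec_nonneg (F := F) (G := G) hv hnonneg k x]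

/-- Lyapunov's criterion. -/
theorem isStablePair_of_lyapunov (hv : 0 ≤ v) {P M : Matrix (Fin n) (Fin n) ℝ}
    (hP : P - lyapunov v F G P = M) (hM : M.PosDef)
    (hnonneg : ∀ x, 0 ≤ x ⬝ᵥ P *ᵥ x) : IsStablePair v F G := fun x => by
  obtain ⟨c, hc⟩ := exists_dotProduct_self_le hM
  have hsum := (summable_lyapunov_pow hv hP (dotProduct_mulVec_nonneg hM) hnonneg x)
  -- With `1 ≤ c • M`, the second moments are dominated by `c` times the terms of a convergent
  -- series.
  refine squeeze_zero
    (fun k => dotProduct_lyapunov_pow_mulVec_nonneg hv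
      (fun y => by simpa using dotProduct_star_self_nonneg y) k x) (fun k => ?_)
    (by simpa using hsum.tendsto_atTop_zero.const_mul c)
  refine (dotProduct_lyapunov_pow_mulVec_mono hv (Y := c • M) (fun y => ?_) k x).trans_eq ?_
  · simpa [smul_mulVec] using hc y
  · simp [smul_mulVec]

end Lyapunov

end StochLQ

/-! ### The Riccati equation and policy iteration as matrix algebra -/

namespace StochLQ

/-- Used twice: with `H = R`, `N = S` it bounds the running cost below, and with `H = controlHessian
P`, `N = crossTerm P` the minimizing gain unfolds to `gain P`. -/
theorem completion_of_squares {n m : ℕ} (M : Matrix (Fin n) (Fin n) ℝ)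
    (N : Matrix (Fin m) (Fin n) ℝ) {H : Matrix (Fin m) (Fin m) ℝ} (hH : H.PosDef)
    (x : Fin n → ℝ) (u : Fin m → ℝ) :
    x ⬝ᵥ M *ᵥ x + 2 * (u ⬝ᵥ N *ᵥ x) + u ⬝ᵥ H *ᵥ u
      = x ⬝ᵥ (M - Nᵀ * H⁻¹ * N) *ᵥ x
        + (u - (-(H⁻¹ * N)) *ᵥ x) ⬝ᵥ H *ᵥ (u - (-(H⁻¹ * N)) *ᵥ x) := by
  have hdet : IsUnit H.det := (isUnit_iff_isUnit_det H).1 hH.isUnit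
  have hHy : H *ᵥ ((H⁻¹ * N) *ᵥ x) = N *ᵥ x := by
    rw [mulVec_mulVec, mul_nonsing_inv_cancel_left _ _ hdet]
  have hy : ((H⁻¹ * N) *ᵥ x) ⬝ᵥ N *ᵥ x = x ⬝ᵥ (Nᵀ * H⁻¹ * N) *ᵥ x := by
    rw [Matrix.mul_assoc, ← mulVec_mulVec x Nᵀ, dotProduct_mulVec x Nᵀ, vecMul_transpose,
      dotProduct_comm]
  rw [neg_mulVec, sub_neg_eq_add, dotProduct_mulVec_add_self (isSymm_of_posDef hH), hHy, hy,
    sub_mulVec, dotProduct_sub]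
  ring

namespace Data

variable {n m : ℕ} (sys : Data n m)

/-- The matrix `Q + K'S + S'K + K'RK` of the running cost under the gain `K`. -/
def closedLoopWeight (K : Matrix (Fin m) (Fin n) ℝ) : Matrix (Fin n) (Fin n) ℝ :=
  sys.Q + Kᵀ * sys.S + sys.Sᵀ * K + Kᵀ * sys.R * K

/-- The Lyapunov operator of the closed loop under the gain `K`. -/
def closedLoopLyapunov (K : Matrix (Fin m) (Fin n) ℝ) :
    Module.End ℝ (Matrix (Fin n) (Fin n) ℝ) :=
  lyapunov ((sys.σ : ℝ) ^ 2) (sys.A + sys.B * K) (sys.C + sys.D * K)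

/-- The algebraic form of mean-square stability of the closed loop under the gain `K`. -/
def IsStabilizingGain (K : Matrix (Fin m) (Fin n) ℝ) : Prop :=
  IsStablePair ((sys.σ : ℝ) ^ 2) (sys.A + sys.B * K) (sys.C + sys.D * K)

/-- The matrix `R + B'PB + σ² D'PD`. -/
def controlHessian (P : Matrix (Fin n) (Fin n) ℝ) : Matrix (Fin m) (Fin m) ℝ :=
  sys.R + sys.Bᵀ * P * sys.B + (sys.σ : ℝ) ^ 2 • (sys.Dᵀ * P * sys.D)

/-- The matrix `B'PA + σ² D'PC + S`. -/
def crossTerm (P : Matrix (Fin n) (Fin n) ℝ) : Matrix (Fin m) (Fin n) ℝ :=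
  sys.Bᵀ * P * sys.A + (sys.σ : ℝ) ^ 2 • (sys.Dᵀ * P * sys.C) + sys.S

/-- The right-hand side of the stochastic algebraic Riccati equation. -/
noncomputable def riccati (P : Matrix (Fin n) (Fin n) ℝ) : Matrix (Fin n) (Fin n) ℝ :=
  sys.Q + sys.Aᵀ * P * sys.A + (sys.σ : ℝ) ^ 2 • (sys.Cᵀ * P * sys.C)
    - (sys.crossTerm P)ᵀ * (sys.controlHessian P)⁻¹ * sys.crossTerm P

/-- The expected value of `y' P y` for the successor state `y` of `x` under the control `u`. -/
def expectedValue (P : Matrix (Fin n) (Fin n) ℝ) (x : Fin n → ℝ) (u : Fin m → ℝ) : ℝ :=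
  (sys.A *ᵥ x + sys.B *ᵥ u) ⬝ᵥ P *ᵥ (sys.A *ᵥ x + sys.B *ᵥ u)
    + (sys.σ : ℝ) ^ 2 *
      ((sys.C *ᵥ x + sys.D *ᵥ u) ⬝ᵥ P *ᵥ (sys.C *ᵥ x + sys.D *ᵥ u))

/-- The excess cost `(u - 𝒦(P) x)' (R + B'PB + σ² D'PD) (u - 𝒦(P) x)` of the control `u`. -/
noncomputable def excessCost (P : Matrix (Fin n) (Fin n) ℝ) (x : Fin n → ℝ) (u : Fin m → ℝ) : ℝ :=
  (u - sys.gain P *ᵥ x) ⬝ᵥ sys.controlHessian P *ᵥ (u - sys.gain P *ᵥ x)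

theorem solvesSARE_iff {P : Matrix (Fin n) (Fin n) ℝ} :
    sys.SolvesSARE P ↔ P = sys.riccati P := Iff.rfl

variable {sys}

theorem isSymm_R (h : sys.WeightsPosDef) : sys.R.IsSymm := isSymm_of_posDef h.1

/-- Symmetry of `Q` is not assumed; it is recovered by adding the symmetric `S' R⁻¹ S` back to `Q -
S' R⁻¹ S`. -/
theorem isSymm_Q (h : sys.WeightsPosDef) : sys.Q.IsSymm := by
  have h1 : (sys.Sᵀ * sys.R⁻¹ * sys.S).IsSymm := by
    rw [Matrix.IsSymm, transpose_mul, transpose_mul, transpose_transpose, transpose_nonsing_inv,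
      (isSymm_R h).eq, Matrix.mul_assoc]
  simpa using (isSymm_of_posDef h.2).add h1

theorem closedLoopWeight_isSymm (h : sys.WeightsPosDef) (K : Matrix (Fin m) (Fin n) ℝ) :
    (sys.closedLoopWeight K).IsSymm := by
  rw [Matrix.IsSymm, closedLoopWeight]
  simp only [transpose_add, transpose_mul, transpose_transpose, (isSymm_R h).eq, (isSymm_Q h).eq,
    Matrix.mul_assoc]
  abel

theorem dotProduct_closedLoopWeight_mulVec (K : Matrix (Fin m) (Fin n) ℝ) (x : Fin n → ℝ) :
    x ⬝ᵥ sys.closedLoopWeight K *ᵥ x = sys.runningCost x (K *ᵥ x) := by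
  have h1 : x ⬝ᵥ (sys.Sᵀ * K) *ᵥ x = (K *ᵥ x) ⬝ᵥ sys.S *ᵥ x := by
    rw [← mulVec_mulVec, dotProduct_mulVec, vecMul_transpose, dotProduct_comm]
  have h2 : x ⬝ᵥ (Kᵀ * sys.S) *ᵥ x = (K *ᵥ x) ⬝ᵥ sys.S *ᵥ x := by
    rw [← mulVec_mulVec, dotProduct_mulVec, vecMul_transpose]
  simp only [closedLoopWeight, runningCost, add_mulVec, dotProduct_add, h1, h2,
    dotProduct_mulVec_conj]
  ring

theorem dotProduct_closedLoopLyapunov_mulVec (K : Matrix (Fin m) (Fin n) ℝ)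
    (P : Matrix (Fin n) (Fin n) ℝ) (x : Fin n → ℝ) :
    x ⬝ᵥ sys.closedLoopLyapunov K P *ᵥ x = sys.expectedValue P x (K *ᵥ x) := by
  rw [closedLoopLyapunov, dotProduct_lyapunov_mulVec, expectedValue]
  simp only [add_mulVec, mulVec_mulVec]

theorem le_runningCost (h : sys.WeightsPosDef) (x : Fin n → ℝ) (u : Fin m → ℝ) :
    x ⬝ᵥ (sys.Q - sys.Sᵀ * sys.R⁻¹ * sys.S) *ᵥ x ≤ sys.runningCost x u := by
  rw [runningCost, completion_of_squares _ _ h.1]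
  exact le_add_of_nonneg_right (dotProduct_mulVec_nonneg h.1 _)

theorem runningCost_nonneg (h : sys.WeightsPosDef) (x : Fin n → ℝ) (u : Fin m → ℝ) :
    0 ≤ sys.runningCost x u :=
  (dotProduct_mulVec_nonneg h.2 x).trans (le_runningCost h x u)

theorem closedLoopWeight_posDef (h : sys.WeightsPosDef) (K : Matrix (Fin m) (Fin n) ℝ) :
    (sys.closedLoopWeight K).PosDef :=
  posDef_of_isSymm (closedLoopWeight_isSymm h K) fun x hx => by
    rw [dotProduct_closedLoopWeight_mulVec]
    exact (dotProduct_mulVec_pos h.2 hx).trans_le (le_runningCost h _ _)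

theorem controlHessian_posDef (h : sys.WeightsPosDef) {P : Matrix (Fin n) (Fin n) ℝ}
    (hP : P.PosDef) : (sys.controlHessian P).PosDef := by
  have hs := (isSymm_of_posDef hP).eq
  refine posDef_of_isSymm ?_ fun u hu => ?_
  · simp only [Matrix.IsSymm, controlHessian, transpose_add, transpose_smul, transpose_mul,
      transpose_transpose, hs, (isSymm_R h).eq, Matrix.mul_assoc]
  · simp only [controlHessian, add_mulVec, smul_mulVec, dotProduct_add, dotProduct_smul,
      dotProduct_mulVec_conj, smul_eq_mul]
    have h1 := dotProduct_mulVec_pos h.1 hu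
    have h2 := dotProduct_mulVec_nonneg hP (sys.B *ᵥ u)
    have h3 := mul_nonneg (sq_nonneg (sys.σ : ℝ)) (dotProduct_mulVec_nonneg hP (sys.D *ᵥ u))
    linarith

theorem riccati_isSymm (h : sys.WeightsPosDef) {P : Matrix (Fin n) (Fin n) ℝ}
    (hP : P.PosDef) : (sys.riccati P).IsSymm := by
  simp only [Matrix.IsSymm, riccati, transpose_add, transpose_sub, transpose_smul, transpose_mul,
    transpose_transpose, transpose_nonsing_inv, (isSymm_of_posDef hP).eq, (isSymm_Q h).eq,
    (isSymm_of_posDef (controlHessian_posDef h hP)).eq, Matrix.mul_assoc]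

theorem excessCost_nonneg (h : sys.WeightsPosDef) {P : Matrix (Fin n) (Fin n) ℝ}
    (hP : P.PosDef) (x : Fin n → ℝ) (u : Fin m → ℝ) : 0 ≤ sys.excessCost P x u :=
  dotProduct_mulVec_nonneg (controlHessian_posDef h hP) _

theorem excessCost_gain (P : Matrix (Fin n) (Fin n) ℝ) (x : Fin n → ℝ) :
    sys.excessCost P x (sys.gain P *ᵥ x) = 0 := by
  simp [excessCost]

/-- The dynamic programming identity, by completion of squares. -/
theorem runningCost_add_expectedValue (h : sys.WeightsPosDef) {P : Matrix (Fin n) (Fin n) ℝ}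
    (hP : P.PosDef) (x : Fin n → ℝ) (u : Fin m → ℝ) :
    sys.runningCost x u + sys.expectedValue P x u
      = x ⬝ᵥ sys.riccati P *ᵥ x + sys.excessCost P x u := by
  have hs := isSymm_of_posDef hP
  refine Eq.trans ?_ (completion_of_squares
    (sys.Q + sys.Aᵀ * P * sys.A + (sys.σ : ℝ) ^ 2 • (sys.Cᵀ * P * sys.C))
    (sys.crossTerm P) (controlHessian_posDef h hP) x u)
  simp only [runningCost, expectedValue, crossTerm, controlHessian, dotProduct_mulVec_add_self hs,
    add_mulVec, smul_mulVec, dotProduct_add, dotProduct_smul, dotProduct_mulVec_conj, smul_eq_mul,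
    dotProduct_mulVec_comm hs (sys.A *ᵥ x) (sys.B *ᵥ u),
    dotProduct_mulVec_comm hs (sys.C *ᵥ x) (sys.D *ᵥ u)]
  ring

/-- The value matrix of the gain `K`: the symmetric solution of the Lyapunov equation. -/
def IsValue (sys : Data n m) (K : Matrix (Fin m) (Fin n) ℝ) (P : Matrix (Fin n) (Fin n) ℝ) :
    Prop :=
  P.IsSymm ∧ P - sys.closedLoopLyapunov K P = sys.closedLoopWeight K

theorem IsStabilizingGain.exists_isValue (h : sys.WeightsPosDef) {K : Matrix (Fin m) (Fin n) ℝ}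
    (hK : sys.IsStabilizingGain K) : ∃ P, sys.IsValue K P :=
  hK.exists_sub_lyapunov_eq (sq_nonneg _) (closedLoopWeight_isSymm h K)

/-- The lower bound does not depend on the gain, so it passes to the limit of policy iteration and
keeps that limit positive definite. -/
theorem IsValue.le (h : sys.WeightsPosDef) {K : Matrix (Fin m) (Fin n) ℝ}
    {P : Matrix (Fin n) (Fin n) ℝ} (hP : sys.IsValue K P) (hK : sys.IsStabilizingGain K)
    (x : Fin n → ℝ) : x ⬝ᵥ (sys.Q - sys.Sᵀ * sys.R⁻¹ * sys.S) *ᵥ x ≤ x ⬝ᵥ P *ᵥ x := by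
  refine le_trans ?_ (hK.le_dotProduct_mulVec (sq_nonneg _) hP.2
    (dotProduct_mulVec_nonneg (closedLoopWeight_posDef h K)) x)
  rw [dotProduct_closedLoopWeight_mulVec]
  exact le_runningCost h _ _

theorem IsValue.posDef (h : sys.WeightsPosDef) {K : Matrix (Fin m) (Fin n) ℝ}
    {P : Matrix (Fin n) (Fin n) ℝ} (hP : sys.IsValue K P) (hK : sys.IsStabilizingGain K) :
    P.PosDef :=
  posDef_of_isSymm hP.1 fun x hx => (dotProduct_mulVec_pos h.2 hx).trans_le (hP.le h hK x)

/-- The deficit in the Lyapunov inequality of a positive definite `P` for the gain `K`. -/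
theorem dotProduct_sub_closedLoopLyapunov_mulVec (h : sys.WeightsPosDef)
    {P : Matrix (Fin n) (Fin n) ℝ} (hP : P.PosDef) (K : Matrix (Fin m) (Fin n) ℝ)
    (x : Fin n → ℝ) :
    x ⬝ᵥ (P - sys.closedLoopLyapunov K P) *ᵥ x
      = x ⬝ᵥ (P - sys.riccati P) *ᵥ x + x ⬝ᵥ sys.closedLoopWeight K *ᵥ x
        - sys.excessCost P x (K *ᵥ x) := by
  have := runningCost_add_expectedValue h hP x (K *ᵥ x)
  rw [sub_mulVec, dotProduct_sub, sub_mulVec, dotProduct_sub, dotProduct_closedLoopWeight_mulVec,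
    dotProduct_closedLoopLyapunov_mulVec]
  linarith

/-- The Lyapunov equation cancels all other terms of the deficit. Consequently every value of a
stabilizing gain is a supersolution of the Riccati equation. -/
theorem IsValue.dotProduct_sub_riccati_mulVec (h : sys.WeightsPosDef)
    {K : Matrix (Fin m) (Fin n) ℝ} {P : Matrix (Fin n) (Fin n) ℝ} (hP : sys.IsValue K P)
    (hK : sys.IsStabilizingGain K) (x : Fin n → ℝ) :
    x ⬝ᵥ (P - sys.riccati P) *ᵥ x = sys.excessCost P x (K *ᵥ x) := by
  have := dotProduct_sub_closedLoopLyapunov_mulVec h (hP.posDef h hK) K x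
  rw [hP.2] at this
  linarith

/-- The improved gain of a supersolution of the Riccati equation is stabilizing. -/
theorem isStabilizingGain_gain (h : sys.WeightsPosDef) {P : Matrix (Fin n) (Fin n) ℝ}
    (hP : P.PosDef) (hsuper : ∀ x, 0 ≤ x ⬝ᵥ (P - sys.riccati P) *ᵥ x) :
    sys.IsStabilizingGain (sys.gain P) := by
  refine isStablePair_of_lyapunov (sq_nonneg _) (P := P) rfl
    (posDef_of_isSymm ?_ fun x hx => ?_) (dotProduct_mulVec_nonneg hP)
  · exact (isSymm_of_posDef hP).sub (lyapunov_isSymm (isSymm_of_posDef hP))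
  · have h1 := dotProduct_sub_closedLoopLyapunov_mulVec h hP (sys.gain P) x
    have h2 := dotProduct_mulVec_pos (closedLoopWeight_posDef h (sys.gain P)) hx
    rw [excessCost_gain] at h1
    have h3 := hsuper x
    rw [closedLoopLyapunov] at h1
    linarith

theorem IsValue.isStabilizingGain_gain (h : sys.WeightsPosDef) {K : Matrix (Fin m) (Fin n) ℝ}
    {P : Matrix (Fin n) (Fin n) ℝ} (hP : sys.IsValue K P) (hK : sys.IsStabilizingGain K) :
    sys.IsStabilizingGain (sys.gain P) := by
  refine Data.isStabilizingGain_gain h (hP.posDef h hK) fun x => ?_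
  rw [hP.dotProduct_sub_riccati_mulVec h hK]
  exact excessCost_nonneg h (hP.posDef h hK) _ _

/-- Comparison of the value of a stabilizing gain `K` with a supersolution for `K`. -/
theorem IsValue.le_of_supersolution {K : Matrix (Fin m) (Fin n) ℝ}
    {P P' : Matrix (Fin n) (Fin n) ℝ} (hP : sys.IsValue K P) (hK : sys.IsStabilizingGain K)
    (hP' : ∀ x, x ⬝ᵥ sys.closedLoopWeight K *ᵥ x
      ≤ x ⬝ᵥ (P' - sys.closedLoopLyapunov K P') *ᵥ x) (x : Fin n → ℝ) :
    x ⬝ᵥ P *ᵥ x ≤ x ⬝ᵥ P' *ᵥ x := by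
  have hdiff : (P' - P) - sys.closedLoopLyapunov K (P' - P)
      = (P' - sys.closedLoopLyapunov K P') - sys.closedLoopWeight K := by
    rw [← hP.2, map_sub]; abel
  have hnonneg : ∀ x, 0 ≤ x ⬝ᵥ ((P' - sys.closedLoopLyapunov K P')
      - sys.closedLoopWeight K) *ᵥ x := fun x => by
    rw [sub_mulVec, dotProduct_sub]
    exact sub_nonneg.2 (hP' x)
  have := (hnonneg x).trans (hK.le_dotProduct_mulVec (sq_nonneg _) hdiff hnonneg x)
  rw [sub_mulVec, dotProduct_sub] at this
  linarith

/-- Comparison of the value of a stabilizing gain `K` with a subsolution for `K`. -/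
theorem IsValue.ge_of_subsolution {K : Matrix (Fin m) (Fin n) ℝ}
    {P P' : Matrix (Fin n) (Fin n) ℝ} (hP : sys.IsValue K P) (hK : sys.IsStabilizingGain K)
    (hP' : ∀ x, x ⬝ᵥ (P' - sys.closedLoopLyapunov K P') *ᵥ x
      ≤ x ⬝ᵥ sys.closedLoopWeight K *ᵥ x) (x : Fin n → ℝ) :
    x ⬝ᵥ P' *ᵥ x ≤ x ⬝ᵥ P *ᵥ x := by
  have hdiff : (P - P') - sys.closedLoopLyapunov K (P - P')
      = sys.closedLoopWeight K - (P' - sys.closedLoopLyapunov K P') := by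
    rw [← hP.2, map_sub]; abel
  have hnonneg : ∀ x, 0 ≤ x ⬝ᵥ (sys.closedLoopWeight K
      - (P' - sys.closedLoopLyapunov K P')) *ᵥ x := fun x => by
    rw [sub_mulVec, dotProduct_sub]
    exact sub_nonneg.2 (hP' x)
  have := (hnonneg x).trans (hK.le_dotProduct_mulVec (sq_nonneg _) hdiff hnonneg x)
  rw [sub_mulVec, dotProduct_sub] at this
  linarith

/-- `P` is a supersolution for its improved gain: its deficit there is the closed-loop weight plus
the Riccati residual, which is nonnegative. -/
theorem IsValue.improvement (h : sys.WeightsPosDef) {K : Matrix (Fin m) (Fin n) ℝ}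
    {P P' : Matrix (Fin n) (Fin n) ℝ} (hP : sys.IsValue K P) (hK : sys.IsStabilizingGain K)
    (hP' : sys.IsValue (sys.gain P) P') (x : Fin n → ℝ) : x ⬝ᵥ P' *ᵥ x ≤ x ⬝ᵥ P *ᵥ x := by
  refine hP'.le_of_supersolution (hP.isStabilizingGain_gain h hK) (fun x => ?_) x
  rw [dotProduct_sub_closedLoopLyapunov_mulVec h (hP.posDef h hK), excessCost_gain,
    hP.dotProduct_sub_riccati_mulVec h hK]
  linarith [excessCost_nonneg h (hP.posDef h hK) x (K *ᵥ x)]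

theorem SolvesSARE.isValue (h : sys.WeightsPosDef) {P : Matrix (Fin n) (Fin n) ℝ}
    (hP : P.PosDef) (hS : sys.SolvesSARE P) : sys.IsValue (sys.gain P) P := by
  have hs := isSymm_of_posDef hP
  refine ⟨hs, eq_of_dotProduct_mulVec_eq (hs.sub (lyapunov_isSymm hs))
    (closedLoopWeight_isSymm h _) fun x => ?_⟩
  have h0 : P - sys.riccati P = 0 := sub_eq_zero.2 ((solvesSARE_iff sys).1 hS)
  rw [dotProduct_sub_closedLoopLyapunov_mulVec h hP, excessCost_gain, h0]
  simp

theorem SolvesSARE.isStabilizingGain (h : sys.WeightsPosDef) {P : Matrix (Fin n) (Fin n) ℝ}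
    (hP : P.PosDef) (hS : sys.SolvesSARE P) : sys.IsStabilizingGain (sys.gain P) := by
  have h0 : P - sys.riccati P = 0 := sub_eq_zero.2 ((solvesSARE_iff sys).1 hS)
  exact isStabilizingGain_gain h hP fun x => by rw [h0]; simp

/-- A Riccati solution is a subsolution for every gain, its deficit being the weight minus an
excess. It therefore lies below `P'`, the value of the stabilizing gain `gain P'`. -/
theorem SolvesSARE.dotProduct_mulVec_le (h : sys.WeightsPosDef)
    {P P' : Matrix (Fin n) (Fin n) ℝ} (hP : P.PosDef) (hS : sys.SolvesSARE P) (hP' : P'.PosDef)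
    (hS' : sys.SolvesSARE P') (x : Fin n → ℝ) : x ⬝ᵥ P *ᵥ x ≤ x ⬝ᵥ P' *ᵥ x := by
  refine (hS'.isValue h hP').ge_of_subsolution (hS'.isStabilizingGain h hP') (fun x => ?_) x
  have h0 : P - sys.riccati P = 0 := sub_eq_zero.2 ((solvesSARE_iff sys).1 hS)
  rw [dotProduct_sub_closedLoopLyapunov_mulVec h hP, h0]
  simpa using excessCost_nonneg h hP x _

theorem SolvesSARE.unique (h : sys.WeightsPosDef) {P P' : Matrix (Fin n) (Fin n) ℝ}
    (hP : P.PosDef) (hS : sys.SolvesSARE P) (hP' : P'.PosDef) (hS' : sys.SolvesSARE P') :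
    P = P' :=
  eq_of_dotProduct_mulVec_eq (isSymm_of_posDef hP) (isSymm_of_posDef hP') fun x =>
    le_antisymm (hS.dotProduct_mulVec_le h hP hP' hS' x) (hS'.dotProduct_mulVec_le h hP' hP hS x)

theorem tendsto_gain (h : sys.WeightsPosDef) {P : ℕ → Matrix (Fin n) (Fin n) ℝ}
    {Y : Matrix (Fin n) (Fin n) ℝ} (hY : Y.PosDef) (hP : Tendsto P atTop (𝓝 Y)) :
    Tendsto (fun i => sys.gain (P i)) atTop (𝓝 (sys.gain Y)) := by
  have hdet : IsUnit (sys.controlHessian Y).det :=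
    (isUnit_iff_isUnit_det _).1 (controlHessian_posDef h hY).isUnit
  have h1 : ContinuousAt (fun X => (sys.controlHessian X)⁻¹) Y := by
    refine ContinuousAt.comp (g := Inv.inv) ?_ (Continuous.continuousAt ?_)
    · exact continuousAt_matrix_inv _ (NormedRing.inverse_continuousAt hdet.unit)
    · unfold controlHessian; fun_prop
  have h2 : ContinuousAt sys.gain Y := by
    have hcross : Continuous sys.crossTerm := by unfold crossTerm; fun_prop
    have hmul : Continuous fun Z : Matrix (Fin m) (Fin m) ℝ × Matrix (Fin m) (Fin n) ℝ =>
        -(Z.1 * Z.2) := by fun_prop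
    exact hmul.continuousAt.comp (h1.prodMk hcross.continuousAt)
  exact h2.tendsto.comp hP

/-- Convergence of exact policy iteration. -/
theorem exists_tendsto_of_isValue (h : sys.WeightsPosDef) {P : ℕ → Matrix (Fin n) (Fin n) ℝ}
    {K : ℕ → Matrix (Fin m) (Fin n) ℝ} (hK : ∀ i, sys.IsStabilizingGain (K i))
    (hP : ∀ i, sys.IsValue (K i) (P (i + 1))) (hgain : ∀ i, K (i + 1) = sys.gain (P (i + 1))) :
    ∃ Y : Matrix (Fin n) (Fin n) ℝ, Tendsto P atTop (𝓝 Y) ∧ Tendsto K atTop (𝓝 (sys.gain Y)) ∧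
      Y.PosDef ∧ sys.SolvesSARE Y := by
  have hanti : ∀ x, Antitone fun i => x ⬝ᵥ P (i + 1) *ᵥ x := fun x =>
    antitone_nat_of_succ_le fun i =>
      (hP i).improvement h (hK i) (by simpa only [hgain] using hP (i + 1)) x
  -- The sequence is shifted by one because `P 0` is arbitrary.
  obtain ⟨Y, hY⟩ := exists_tendsto_of_dotProduct_mulVec (X := fun i => P (i + 1))
    (fun i => (hP i).1) fun x => ⟨_, tendsto_atTop_ciInf (hanti x) ⟨0, by
      rintro _ ⟨i, rfl⟩
      exact dotProduct_mulVec_nonneg ((hP i).posDef h (hK i)) x⟩⟩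
  have hYs : Y.IsSymm := isSymm_of_tendsto (fun i => (hP i).1) hY
  have hYpos : Y.PosDef := posDef_of_isSymm hYs fun x hx =>
    (dotProduct_mulVec_pos h.2 hx).trans_le
      (ge_of_tendsto' (tendsto_dotProduct_mulVec hY x) fun i => (hP i).le h (hK i) x)
  have hKlim : Tendsto (fun i => K (i + 1)) atTop (𝓝 (sys.gain Y)) := by
    simpa only [hgain] using tendsto_gain h hYpos hY
  refine ⟨Y, (tendsto_add_atTop_iff_nat 1).1 hY, (tendsto_add_atTop_iff_nat 1).1 hKlim, hYpos, ?_⟩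
  -- The Lyapunov equations pass to the limit jointly in gain and value. At `gain Y` the excess
  -- vanishes, so the limiting equation is the Riccati equation.
  have hcont : Continuous fun Z : Matrix (Fin m) (Fin n) ℝ × Matrix (Fin n) (Fin n) ℝ =>
      Z.2 - sys.closedLoopLyapunov Z.1 Z.2 - sys.closedLoopWeight Z.1 := by
    simp only [closedLoopLyapunov, lyapunov, closedLoopWeight, LinearMap.coe_mk, AddHom.coe_mk]
    fun_prop
  have hlim := (hcont.tendsto (sys.gain Y, Y)).comp
    (hKlim.prodMk_nhds ((tendsto_add_atTop_iff_nat 1).2 hY))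
  have hzero : ∀ i, P (i + 1 + 1) - sys.closedLoopLyapunov (K (i + 1)) (P (i + 1 + 1))
      - sys.closedLoopWeight (K (i + 1)) = 0 := fun i => sub_eq_zero.2 (hP (i + 1)).2
  simp only [Function.comp_def, hzero] at hlim
  have hval : Y - sys.closedLoopLyapunov (sys.gain Y) Y - sys.closedLoopWeight (sys.gain Y) = 0 :=
    tendsto_nhds_unique hlim tendsto_const_nhds
  rw [solvesSARE_iff]
  refine eq_of_dotProduct_mulVec_eq hYs (riccati_isSymm h hYpos) fun x => ?_
  have := dotProduct_sub_closedLoopLyapunov_mulVec h hYpos (sys.gain Y) x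
  rw [sub_eq_zero.1 hval, excessCost_gain, sub_mulVec, dotProduct_sub] at this
  linarith

end Data

end StochLQ

/-! ### Second moments of the dynamics and policy evaluation -/

namespace StochLQ

section SquareIntegrable

variable {n m : ℕ} {Ω : Type*} {mΩ : MeasurableSpace Ω} {μ : Measure Ω}

/-- Square-integrable random vectors that are measurable with respect to `𝒢`. -/
structure IsSqIntegrable (μ : Measure Ω) (𝒢 : MeasurableSpace Ω) (y : Ω → Fin n → ℝ) : Prop where
  measurable : Measurable[𝒢] y
  memLp : ∀ i, MemLp (fun ω => y ω i) 2 μ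

namespace IsSqIntegrable

variable {𝒢 : MeasurableSpace Ω} {y : Ω → Fin n → ℝ} {z : Ω → Fin m → ℝ}

theorem const [IsFiniteMeasure μ] (c : Fin n → ℝ) : IsSqIntegrable μ 𝒢 fun _ => c :=
  ⟨measurable_const, fun _ => memLp_const _⟩

theorem add {y' : Ω → Fin n → ℝ} (hy : IsSqIntegrable μ 𝒢 y) (hy' : IsSqIntegrable μ 𝒢 y') :
    IsSqIntegrable μ 𝒢 fun ω => y ω + y' ω :=
  ⟨hy.measurable.add hy'.measurable, fun i => (hy.memLp i).add (hy'.memLp i)⟩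

theorem mulVec (hy : IsSqIntegrable μ 𝒢 y) (X : Matrix (Fin m) (Fin n) ℝ) :
    IsSqIntegrable μ 𝒢 fun ω => X *ᵥ y ω :=
  ⟨(by fun_prop : Measurable fun x : Fin n → ℝ => X *ᵥ x).comp hy.measurable, fun i =>
    memLp_finsetSum Finset.univ fun j _ => (hy.memLp j).const_mul (X i j)⟩

theorem mono {𝒢' : MeasurableSpace Ω} (hy : IsSqIntegrable μ 𝒢 y) (h : 𝒢 ≤ 𝒢') :
    IsSqIntegrable μ 𝒢' y :=
  ⟨hy.measurable.mono h le_rfl, hy.memLp⟩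

theorem integrable_dotProduct {y' : Ω → Fin n → ℝ} (hy : IsSqIntegrable μ 𝒢 y)
    (hy' : IsSqIntegrable μ 𝒢 y') : Integrable (fun ω => y ω ⬝ᵥ y' ω) μ :=
  integrable_finsetSum _ fun i _ => (hy.memLp i).integrable_mul (hy'.memLp i)

theorem integrable_dotProduct_mulVec (hy : IsSqIntegrable μ 𝒢 y)
    (X : Matrix (Fin n) (Fin m) ℝ) (hz : IsSqIntegrable μ 𝒢 z) :
    Integrable (fun ω => y ω ⬝ᵥ X *ᵥ z ω) μ :=
  hy.integrable_dotProduct (hz.mulVec X)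

theorem measurable_dotProduct_mulVec (hy : IsSqIntegrable μ 𝒢 y)
    (X : Matrix (Fin n) (Fin m) ℝ) (hz : IsSqIntegrable μ 𝒢 z) :
    Measurable[𝒢] (fun ω => y ω ⬝ᵥ X *ᵥ z ω) :=
  (by fun_prop : Measurable fun p : (Fin n → ℝ) × (Fin m → ℝ) => p.1 ⬝ᵥ X *ᵥ p.2).comp
    (hy.measurable.prodMk hz.measurable)

end IsSqIntegrable

theorem isSqIntegrable_of_lintegral {ℱ : Filtration ℕ mΩ} {t : ℕ} {y : Ω → Fin n → ℝ}
    (hy : Measurable[ℱ t] y) (h : ∫⁻ ω, ENNReal.ofReal (y ω ⬝ᵥ y ω) ∂μ < ∞) :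
    IsSqIntegrable μ (ℱ t) y := by
  refine ⟨hy, fun i => ?_⟩
  have hm : Measurable fun ω => y ω i := (measurable_pi_apply i).comp (hy.mono (ℱ.le t) le_rfl)
  refine (memLp_two_iff_integrable_sq hm.aestronglyMeasurable).2
    ⟨(hm.pow_const 2).aestronglyMeasurable, ?_⟩
  rw [hasFiniteIntegral_iff_ofReal (ae_of_all _ fun ω => sq_nonneg _)]
  exact (lintegral_mono fun ω => ENNReal.ofReal_le_ofReal (sq_le_dotProduct_self _ i)).trans_lt h

end SquareIntegrable

namespace IsGaussianNoise

variable {n m : ℕ} {Ω : Type*} {mΩ : MeasurableSpace Ω} {μ : Measure Ω}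
  {ℱ : Filtration ℕ mΩ} {w : ℕ → Ω → ℝ} {σ : ℝ≥0}

theorem memLp (hw : IsGaussianNoise μ ℱ w σ) (t : ℕ) : MemLp (w t) 2 μ := by
  have h := memLp_id_gaussianReal (μ := 0) (v := σ ^ 2) 2
  rw [← (hw.law t).map_eq] at h
  exact (memLp_map_measure_iff aestronglyMeasurable_id (hw.law t).aemeasurable).1 h

theorem integral_eq_zero (hw : IsGaussianNoise μ ℱ w σ) (t : ℕ) : ∫ ω, w t ω ∂μ = 0 := by
  rw [(hw.law t).integral_eq, integral_id_gaussianReal]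

theorem integral_sq (hw : IsGaussianNoise μ ℱ w σ) (t : ℕ) :
    ∫ ω, w t ω ^ 2 ∂μ = (σ : ℝ) ^ 2 := by
  have h := (hw.law t).variance_eq
  rw [variance_id_gaussianReal,
    variance_of_integral_eq_zero (hw.law t).aemeasurable (hw.integral_eq_zero t)] at h
  simpa using h

theorem measurable (hw : IsGaussianNoise μ ℱ w σ) (t : ℕ) : Measurable (w t) :=
  (hw.adapted t).mono (ℱ.le _) le_rfl

theorem indepFun (hw : IsGaussianNoise μ ℱ w σ) {t : ℕ} {f : Ω → ℝ} (hf : Measurable[ℱ t] f) :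
    IndepFun (w t) f μ := by
  rw [IndepFun_iff_Indep]
  exact indep_of_indep_of_le_right (hw.indep t) hf.comap_le

theorem integrable_mul (hw : IsGaussianNoise μ ℱ w σ) {t : ℕ} {f : Ω → ℝ} {g : ℝ → ℝ}
    (hg : Measurable g) (hgi : Integrable (fun ω => g (w t ω)) μ) (hf : Measurable[ℱ t] f)
    (hfi : Integrable f μ) : Integrable (fun ω => g (w t ω) * f ω) μ :=
  ((hw.indepFun hf).comp hg measurable_id).integrable_mul hgi hfi

/-- The indicator of `E` is absorbed into the past factor, which stays independent of `w t`. -/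
theorem setIntegral_mul (hw : IsGaussianNoise μ ℱ w σ) {t : ℕ} {f : Ω → ℝ} {g : ℝ → ℝ}
    (hg : Measurable g) (hf : Measurable[ℱ t] f) {E : Set Ω} (hE : MeasurableSet[ℱ t] E) :
    ∫ ω in E, g (w t ω) * f ω ∂μ = (∫ ω, g (w t ω) ∂μ) * ∫ ω in E, f ω ∂μ := by
  have hfE : Measurable[ℱ t] (E.indicator f) := hf.indicator hE
  rw [← integral_indicator (ℱ.le t _ hE), ← integral_indicator (ℱ.le t _ hE)]
  have := ((hw.indepFun hfE).comp hg measurable_id).integral_fun_mul_eq_mul_integral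
    (hg.comp (hw.measurable t)).aestronglyMeasurable
    (hfE.mono (ℱ.le t) le_rfl).aestronglyMeasurable
  refine Eq.trans (integral_congr_ae (ae_of_all _ fun ω => ?_)) this
  by_cases h : ω ∈ E <;> simp [h]

/-- Square integrability is propagated by a step of the dynamics. -/
theorem isSqIntegrable_step (hw : IsGaussianNoise μ ℱ w σ) {t : ℕ} {y z : Ω → Fin n → ℝ}
    (hy : IsSqIntegrable μ (ℱ t) y) (hz : IsSqIntegrable μ (ℱ t) z) :
    IsSqIntegrable μ (ℱ (t + 1)) fun ω => y ω + w t ω • z ω := by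
  refine (hy.mono (ℱ.mono t.le_succ)).add ⟨(hw.adapted t).smul
    (hz.measurable.mono (ℱ.mono t.le_succ) le_rfl), fun i => ?_⟩
  have hzi : Measurable[ℱ t] fun ω => z ω i := (measurable_pi_apply i).comp hz.measurable
  have hm := (hw.measurable t).mul (hzi.mono (ℱ.le t) le_rfl)
  refine (memLp_two_iff_integrable_sq hm.aestronglyMeasurable).2 ?_
  simp only [Pi.mul_apply, mul_pow]
  -- Independence replaces Hölder: the product of the two independent integrable squares is
  -- integrable.
  exact hw.integrable_mul (g := fun r => r ^ 2) (by fun_prop) (hw.memLp t).integrable_sq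
    (hzi.pow_const 2) (hz.memLp i).integrable_sq

/-- The second moments after a step of the dynamics, localized to an event of the past. -/
theorem setIntegral_step [IsFiniteMeasure μ] (hw : IsGaussianNoise μ ℱ w σ) {t : ℕ}
    {y z : Ω → Fin n → ℝ} (hy : IsSqIntegrable μ (ℱ t) y) (hz : IsSqIntegrable μ (ℱ t) z)
    {X : Matrix (Fin n) (Fin n) ℝ} (hX : X.IsSymm) {E : Set Ω} (hE : MeasurableSet[ℱ t] E) :
    ∫ ω in E, (y ω + w t ω • z ω) ⬝ᵥ X *ᵥ (y ω + w t ω • z ω) ∂μ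
      = ∫ ω in E, (y ω ⬝ᵥ X *ᵥ y ω + (σ : ℝ) ^ 2 * (z ω ⬝ᵥ X *ᵥ z ω)) ∂μ := by
  have hyy := hy.integrable_dotProduct_mulVec X hy
  have hyz := hy.integrable_dotProduct_mulVec X hz
  have hzz := hz.integrable_dotProduct_mulVec X hz
  have hyz' := hy.measurable_dotProduct_mulVec X hz
  have hzz' := hz.measurable_dotProduct_mulVec X hz
  have h1 := hw.integrable_mul measurable_id ((hw.memLp t).integrable one_le_two) hyz' hyz
  have h2 := hw.integrable_mul (g := fun r => r ^ 2) (by fun_prop) (hw.memLp t).integrable_sq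
    hzz' hzz
  -- The cross term carries the factor `E[w t] = 0`, the quadratic one `E[w t ^ 2] = σ ^ 2`.
  have e1 := hw.setIntegral_mul measurable_id hyz' hE
  have e2 := hw.setIntegral_mul (g := fun r => r ^ 2) (by fun_prop) hzz' hE
  simp only [id, hw.integral_eq_zero, zero_mul, hw.integral_sq] at h1 e1 e2
  have hexp : ∀ ω, (y ω + w t ω • z ω) ⬝ᵥ X *ᵥ (y ω + w t ω • z ω)
      = y ω ⬝ᵥ X *ᵥ y ω + 2 * (w t ω * (y ω ⬝ᵥ X *ᵥ z ω)) + w t ω ^ 2 * (z ω ⬝ᵥ X *ᵥ z ω) :=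
    fun ω => by
      rw [dotProduct_mulVec_add_self hX]
      simp only [mulVec_smul, dotProduct_smul, smul_dotProduct, smul_eq_mul]
      ring
  have h3 : Integrable (fun ω => y ω ⬝ᵥ X *ᵥ y ω + 2 * (w t ω * (y ω ⬝ᵥ X *ᵥ z ω))) μ :=
    hyy.add (h1.const_mul 2)
  simp only [hexp]
  rw [integral_add h3.integrableOn h2.integrableOn,
    integral_add hyy.integrableOn (h1.const_mul 2).integrableOn, integral_const_mul, e1, e2,
    integral_add hyy.integrableOn (hzz.const_mul _).integrableOn, integral_const_mul]
  ring

variable {F G : Matrix (Fin n) (Fin n) ℝ} {s : ℕ} {ξ : Fin n → ℝ}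

theorem autState_succ (w : ℕ → Ω → ℝ) (F G : Matrix (Fin n) (Fin n) ℝ) (s : ℕ) (ξ : Fin n → ℝ)
    (k : ℕ) (ω : Ω) : autState w F G s ξ (k + 1) ω
      = F *ᵥ autState w F G s ξ k ω + w (s + k) ω • (G *ᵥ autState w F G s ξ k ω) := by
  rw [autState, add_mulVec, smul_mulVec]

theorem isSqIntegrable_autState [IsFiniteMeasure μ] (hw : IsGaussianNoise μ ℱ w σ) (k : ℕ) :
    IsSqIntegrable μ (ℱ (s + k)) (autState w F G s ξ k) := by
  induction k with
  | zero => exact .const ξ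
  | succ k ih =>
    simp only [funext (autState_succ w F G s ξ k)]
    exact hw.isSqIntegrable_step (ih.mulVec F) (ih.mulVec G)

/-- Averaging out the last noise replaces `X` by its Lyapunov image, hence the induction over all
`X`. Having the identity on every event of `ℱ s` makes the conditional moments deterministic. -/
theorem setIntegral_autState [IsFiniteMeasure μ] (hw : IsGaussianNoise μ ℱ w σ)
    {X : Matrix (Fin n) (Fin n) ℝ} (hX : X.IsSymm) {E : Set Ω} (hE : MeasurableSet[ℱ s] E)
    (k : ℕ) :
    ∫ ω in E, autState w F G s ξ k ω ⬝ᵥ X *ᵥ autState w F G s ξ k ω ∂μ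
      = μ.real E * (ξ ⬝ᵥ (lyapunov ((σ : ℝ) ^ 2) F G ^ k) X *ᵥ ξ) := by
  induction k generalizing X with
  | zero => simp [autState]
  | succ k ih =>
    have hx := hw.isSqIntegrable_autState (F := F) (G := G) (s := s) (ξ := ξ) k
    simp only [autState_succ]
    rw [hw.setIntegral_step (hx.mulVec F) (hx.mulVec G) hX (ℱ.mono (Nat.le_add_right s k) _ hE)]
    simp only [← dotProduct_lyapunov_mulVec]
    rw [ih (lyapunov_isSymm hX), pow_succ (lyapunov _ F G), Module.End.mul_apply]

theorem integral_autState [IsProbabilityMeasure μ] (hw : IsGaussianNoise μ ℱ w σ)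
    {X : Matrix (Fin n) (Fin n) ℝ} (hX : X.IsSymm) (k : ℕ) :
    ∫ ω, autState w F G s ξ k ω ⬝ᵥ X *ᵥ autState w F G s ξ k ω ∂μ
      = ξ ⬝ᵥ (lyapunov ((σ : ℝ) ^ 2) F G ^ k) X *ᵥ ξ := by
  simpa using hw.setIntegral_autState (F := F) (G := G) (ξ := ξ) hX
    (MeasurableSet.univ (α := Ω) (m := ℱ s)) k

theorem isMeanSquareStable_iff [IsProbabilityMeasure μ] (hw : IsGaussianNoise μ ℱ w σ) :
    IsMeanSquareStable μ w F G ↔ IsStablePair ((σ : ℝ) ^ 2) F G := by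
  refine forall_congr' fun ξ => ?_
  have := fun k => hw.integral_autState (F := F) (G := G) (s := 0) (ξ := ξ) isSymm_one k
  simp only [one_mulVec] at this
  simp only [this]

theorem lintegral_autState [IsProbabilityMeasure μ] (hw : IsGaussianNoise μ ℱ w σ)
    {X : Matrix (Fin n) (Fin n) ℝ} (hX : X.IsSymm) (hnonneg : ∀ x, 0 ≤ x ⬝ᵥ X *ᵥ x) (k : ℕ) :
    ∫⁻ ω, ENNReal.ofReal (autState w F G s ξ k ω ⬝ᵥ X *ᵥ autState w F G s ξ k ω) ∂μ
      = ENNReal.ofReal (ξ ⬝ᵥ (lyapunov ((σ : ℝ) ^ 2) F G ^ k) X *ᵥ ξ) := by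
  have hx := hw.isSqIntegrable_autState (F := F) (G := G) (s := s) (ξ := ξ) k
  rw [← hw.integral_autState hX, ofReal_integral_eq_lintegral_ofReal
    (hx.integrable_dotProduct_mulVec X hx) (ae_of_all _ fun ω => hnonneg _)]

end IsGaussianNoise

theorem condExp_ae_eq_const {Ω : Type*} {mΩ : MeasurableSpace Ω} {μ : Measure Ω}
    [IsFiniteMeasure μ] {𝒢 : MeasurableSpace Ω} (h𝒢 : 𝒢 ≤ mΩ) {f : Ω → ℝ} (hf : Integrable f μ)
    {c : ℝ} (h : ∀ E, MeasurableSet[𝒢] E → ∫ ω in E, f ω ∂μ = μ.real E * c) :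
    μ[f | 𝒢] =ᵐ[μ] fun _ => c :=
  (ae_eq_condExp_of_forall_setIntegral_eq h𝒢 hf (fun _ _ _ => integrable_const c)
    (fun E hE _ => by simp [h E hE]) aestronglyMeasurable_const).symm

namespace Data

variable {n m : ℕ} {sys : Data n m} {Ω : Type*} {mΩ : MeasurableSpace Ω} {μ : Measure Ω}
  {ℱ : Filtration ℕ mΩ} {w : ℕ → Ω → ℝ} {s l : ℕ} {ξ : Fin n → ℝ}

theorem mem_stabilizers_iff [IsProbabilityMeasure μ] (hw : IsGaussianNoise μ ℱ w sys.σ)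
    {K : Matrix (Fin m) (Fin n) ℝ} : K ∈ sys.stabilizers μ w ↔ sys.IsStabilizingGain K :=
  hw.isMeanSquareStable_iff

theorem IsStabilizingGain.isAdmissible [IsProbabilityMeasure μ]
    (hw : IsGaussianNoise μ ℱ w sys.σ) {K : Matrix (Fin m) (Fin n) ℝ}
    (hK : sys.IsStabilizingGain K) (s : ℕ) (ξ : Fin n → ℝ) :
    sys.IsAdmissible μ ℱ w s ξ (sys.feedback w K s ξ) where
  adapted k := ((hw.isSqIntegrable_autState k).mulVec K).measurable
  sq_integrable := by
    have hsymm : (Kᵀ * K).IsSymm := by simp [Matrix.IsSymm]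
    have hquad : ∀ x, x ⬝ᵥ (Kᵀ * K) *ᵥ x = (K *ᵥ x) ⬝ᵥ (K *ᵥ x) := fun x => by
      simpa using dotProduct_mulVec_conj K 1 K x x
    have hnonneg : ∀ x, 0 ≤ x ⬝ᵥ (Kᵀ * K) *ᵥ x := fun x => by
      simpa [hquad] using dotProduct_star_self_nonneg (K *ᵥ x)
    -- The control energy is a running cost with weight `K' K`; the solution of its Lyapunov
    -- equation bounds the total.
    obtain ⟨P, -, hP⟩ := hK.exists_sub_lyapunov_eq (sq_nonneg _) hsymm
    have hsum := summable_lyapunov_pow (sq_nonneg _) hP hnonneg (fun x =>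
      (hnonneg x).trans (hK.le_dotProduct_mulVec (sq_nonneg _) hP hnonneg x)) ξ
    have heq : ∀ k, ∫⁻ ω, ENNReal.ofReal (sys.feedback w K s ξ k ω ⬝ᵥ sys.feedback w K s ξ k ω) ∂μ
        = ENNReal.ofReal (ξ ⬝ᵥ (lyapunov ((sys.σ : ℝ) ^ 2) (sys.A + sys.B * K)
          (sys.C + sys.D * K) ^ k) (Kᵀ * K) *ᵥ ξ) := fun k => by
      rw [← hw.lintegral_autState hsymm hnonneg]
      simp only [hquad]
      rfl
    simp only [heq]
    rw [← ENNReal.ofReal_tsum_of_nonneg (fun k =>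
      dotProduct_lyapunov_pow_mulVec_nonneg (sq_nonneg _) hnonneg k ξ) hsum]
    exact ENNReal.ofReal_lt_top
  stabilizing := by
    have h := fun k => hw.lintegral_autState (F := sys.A + sys.B * K) (G := sys.C + sys.D * K)
      (s := s) (ξ := ξ) isSymm_one (fun x => by simpa using dotProduct_star_self_nonneg x) k
    simp only [one_mulVec] at h
    simp only [state_feedback, closedLoop, h]
    simpa using ENNReal.tendsto_ofReal (hK ξ)

/-- Evaluation on `[s, s + l + 1]` is the Lyapunov equation summed over `l + 1` steps. Under
stability the summed equation has only one symmetric solution, so it loses nothing. -/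
theorem IsStabilizingGain.policyEvaluation_iff [IsProbabilityMeasure μ] (h : sys.WeightsPosDef)
    (hw : IsGaussianNoise μ ℱ w sys.σ) {K : Matrix (Fin m) (Fin n) ℝ}
    (hK : sys.IsStabilizingGain K) {P : Matrix (Fin n) (Fin n) ℝ} (hP : P.IsSymm) :
    sys.PolicyEvaluation μ ℱ w s l K P ↔ sys.IsValue K P := by
  have hW := closedLoopWeight_isSymm h K
  have hx : ∀ ξ k, IsSqIntegrable μ (ℱ (s + k)) (sys.closedLoop w K s ξ k) :=
    fun ξ k => hw.isSqIntegrable_autState k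
  have hint : ∀ (X : Matrix (Fin n) (Fin n) ℝ) ξ k, Integrable (fun ω =>
      sys.closedLoop w K s ξ k ω ⬝ᵥ X *ᵥ sys.closedLoop w K s ξ k ω) μ :=
    fun X ξ k => (hx ξ k).integrable_dotProduct_mulVec X (hx ξ k)
  have h1 : ∀ ξ, μ[fun ω => sys.closedLoop w K s ξ (l + 1) ω ⬝ᵥ
      P *ᵥ sys.closedLoop w K s ξ (l + 1) ω | ℱ s]
      =ᵐ[μ] fun _ => ξ ⬝ᵥ (sys.closedLoopLyapunov K ^ (l + 1)) P *ᵥ ξ := fun ξ =>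
    condExp_ae_eq_const (ℱ.le s) (hint P ξ _) fun E hE => hw.setIntegral_autState hP hE _
  have h2 : ∀ ξ, μ[fun ω => ∑ k ∈ Finset.range (l + 1), sys.closedLoop w K s ξ k ω ⬝ᵥ
      (sys.Q + Kᵀ * sys.S + sys.Sᵀ * K + Kᵀ * sys.R * K) *ᵥ sys.closedLoop w K s ξ k ω | ℱ s]
      =ᵐ[μ] fun _ => ξ ⬝ᵥ (∑ k ∈ Finset.range (l + 1),
        (sys.closedLoopLyapunov K ^ k) (sys.closedLoopWeight K)) *ᵥ ξ := fun ξ => by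
    refine condExp_ae_eq_const (ℱ.le s) (integrable_finsetSum _ fun k _ => hint _ ξ k)
      fun E hE => ?_
    rw [integral_finsetSum _ fun k _ => (hint _ ξ k).integrableOn, sum_mulVec, dotProduct_sum,
      Finset.mul_sum]
    exact Finset.sum_congr rfl fun k _ => hw.setIntegral_autState hW hE k
  have hiff : sys.PolicyEvaluation μ ℱ w s l K P ↔ P - (sys.closedLoopLyapunov K ^ (l + 1)) P
      = ∑ k ∈ Finset.range (l + 1), (sys.closedLoopLyapunov K ^ k) (sys.closedLoopWeight K) := by
    have hsymm : (∑ k ∈ Finset.range (l + 1),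
        (sys.closedLoopLyapunov K ^ k) (sys.closedLoopWeight K)).IsSymm := by
      rw [Matrix.IsSymm, transpose_sum]
      exact Finset.sum_congr rfl fun k _ => lyapunov_pow_isSymm hW k
    constructor
    · refine fun hPE => eq_of_dotProduct_mulVec_eq (hP.sub (lyapunov_pow_isSymm hP _)) hsymm
        fun ξ => ?_
      have hae : ∀ᵐ _ ∂μ, ξ ⬝ᵥ P *ᵥ ξ - ξ ⬝ᵥ (sys.closedLoopLyapunov K ^ (l + 1)) P *ᵥ ξ
          = ξ ⬝ᵥ (∑ k ∈ Finset.range (l + 1),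
            (sys.closedLoopLyapunov K ^ k) (sys.closedLoopWeight K)) *ᵥ ξ := by
        filter_upwards [hPE ξ, h1 ξ, h2 ξ] with ω h3 h4 h5
        rw [← h5, ← h3, h4]
      rw [sub_mulVec, dotProduct_sub]
      -- Both sides are constants and `μ` is a probability measure, so one sample point suffices.
      exact hae.exists.choose_spec
    · intro heq ξ
      filter_upwards [h1 ξ, h2 ξ] with ω h4 h5
      rw [h4, h5, ← heq, sub_mulVec, dotProduct_sub]
  rw [hiff]
  constructor
  · intro heq
    obtain ⟨P₀, hP₀, hval⟩ := hK.exists_isValue h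
    have h0 := sub_lyapunov_pow hval (l + 1)
    have hfix : P - P₀ = 0 := by
      refine IsStablePair.eq_zero hK (sq_nonneg _) (hP.sub hP₀) (k := l) ?_
      have h3 : P - (sys.closedLoopLyapunov K ^ (l + 1)) P
        = P₀ - (sys.closedLoopLyapunov K ^ (l + 1)) P₀ := heq.trans h0.symm
      change (sys.closedLoopLyapunov K ^ (l + 1)) (P - P₀) = P - P₀
      rw [map_sub]
      rw [← sub_eq_zero, ← neg_eq_zero, ← sub_eq_zero.2 h3]
      abel
    rw [sub_eq_zero.1 hfix]
    exact ⟨hP₀, hval⟩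
  · exact fun hval => sub_lyapunov_pow hval.2 (l + 1)

end Data

end StochLQ

/-! ### Verification, optimality and runs of the algorithm -/

namespace StochLQ

namespace Data

variable {n m : ℕ} {sys : Data n m} {Ω : Type*} {mΩ : MeasurableSpace Ω} {μ : Measure Ω}
  {ℱ : Filtration ℕ mΩ} {w : ℕ → Ω → ℝ} {s : ℕ} {ξ : Fin n → ℝ} {u : ℕ → Ω → Fin m → ℝ}

theorem IsAdmissible.isSqIntegrable (hu : sys.IsAdmissible μ ℱ w s ξ u) (k : ℕ) :
    IsSqIntegrable μ (ℱ (s + k)) (u k) :=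
  isSqIntegrable_of_lintegral (hu.adapted k) ((ENNReal.le_tsum k).trans_lt hu.sq_integrable)

theorem IsAdmissible.isSqIntegrable_state [IsFiniteMeasure μ] (hw : IsGaussianNoise μ ℱ w sys.σ)
    (hu : sys.IsAdmissible μ ℱ w s ξ u) (k : ℕ) :
    IsSqIntegrable μ (ℱ (s + k)) (sys.state w s ξ u k) := by
  induction k with
  | zero => exact .const ξ
  | succ k ih =>
    have hk := hu.isSqIntegrable k
    exact hw.isSqIntegrable_step ((ih.mulVec sys.A).add (hk.mulVec sys.B))
      ((ih.mulVec sys.C).add (hk.mulVec sys.D))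

theorem IsAdmissible.setIntegral_state_succ [IsFiniteMeasure μ]
    (hw : IsGaussianNoise μ ℱ w sys.σ) (hu : sys.IsAdmissible μ ℱ w s ξ u)
    {P : Matrix (Fin n) (Fin n) ℝ} (hP : P.IsSymm) {E : Set Ω} (hE : MeasurableSet[ℱ s] E)
    (k : ℕ) :
    ∫ ω in E, sys.state w s ξ u (k + 1) ω ⬝ᵥ P *ᵥ sys.state w s ξ u (k + 1) ω ∂μ
      = ∫ ω in E, sys.expectedValue P (sys.state w s ξ u k ω) (u k ω) ∂μ := by
  have hx := hu.isSqIntegrable_state hw k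
  have hk := hu.isSqIntegrable k
  exact hw.setIntegral_step ((hx.mulVec sys.A).add (hk.mulVec sys.B))
    ((hx.mulVec sys.C).add (hk.mulVec sys.D)) hP (ℱ.mono (Nat.le_add_right s k) _ hE)

theorem _root_.StochLQ.IsSqIntegrable.integrable_runningCost {𝒢 : MeasurableSpace Ω}
    {x : Ω → Fin n → ℝ} {y : Ω → Fin m → ℝ} (hx : IsSqIntegrable μ 𝒢 x)
    (hy : IsSqIntegrable μ 𝒢 y) : Integrable (fun ω => sys.runningCost (x ω) (y ω)) μ :=
  ((hx.integrable_dotProduct_mulVec _ hx).add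
    ((hy.integrable_dotProduct_mulVec _ hx).const_mul 2)).add (hy.integrable_dotProduct_mulVec _ hy)

theorem _root_.StochLQ.IsSqIntegrable.integrable_expectedValue {𝒢 : MeasurableSpace Ω}
    {x : Ω → Fin n → ℝ} {y : Ω → Fin m → ℝ} (hx : IsSqIntegrable μ 𝒢 x)
    (hy : IsSqIntegrable μ 𝒢 y) (P : Matrix (Fin n) (Fin n) ℝ) :
    Integrable (fun ω => sys.expectedValue P (x ω) (y ω)) μ := by
  have h1 := (hx.mulVec sys.A).add (hy.mulVec sys.B)
  have h2 := (hx.mulVec sys.C).add (hy.mulVec sys.D)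
  exact (h1.integrable_dotProduct_mulVec _ h1).add
    ((h2.integrable_dotProduct_mulVec _ h2).const_mul _)

theorem _root_.StochLQ.IsSqIntegrable.integrable_excessCost {𝒢 : MeasurableSpace Ω}
    {x : Ω → Fin n → ℝ} {y : Ω → Fin m → ℝ} (hx : IsSqIntegrable μ 𝒢 x)
    (hy : IsSqIntegrable μ 𝒢 y) (P : Matrix (Fin n) (Fin n) ℝ) :
    Integrable (fun ω => sys.excessCost P (x ω) (y ω)) μ := by
  have h : IsSqIntegrable μ 𝒢 fun ω => y ω - sys.gain P *ᵥ x ω := by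
    simpa only [neg_mulVec, ← sub_eq_add_neg] using hy.add (hx.mulVec (-sys.gain P))
  exact h.integrable_dotProduct_mulVec _ h

/-- The verification identity on a finite horizon, localized to an event of the initial
information. -/
theorem IsAdmissible.sum_setIntegral_runningCost [IsFiniteMeasure μ] (h : sys.WeightsPosDef)
    (hw : IsGaussianNoise μ ℱ w sys.σ) (hu : sys.IsAdmissible μ ℱ w s ξ u)
    {P : Matrix (Fin n) (Fin n) ℝ} (hP : P.PosDef) (hS : sys.SolvesSARE P)
    {E : Set Ω} (hE : MeasurableSet[ℱ s] E) (N : ℕ) :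
    ∑ k ∈ Finset.range N, ∫ ω in E, sys.runningCost (sys.state w s ξ u k ω) (u k ω) ∂μ
        + ∫ ω in E, sys.state w s ξ u N ω ⬝ᵥ P *ᵥ sys.state w s ξ u N ω ∂μ
      = μ.real E * (ξ ⬝ᵥ P *ᵥ ξ)
        + ∑ k ∈ Finset.range N, ∫ ω in E, sys.excessCost P (sys.state w s ξ u k ω) (u k ω) ∂μ := by
  induction N with
  | zero => simp [state]
  | succ N ih =>
    have hx := hu.isSqIntegrable_state hw N
    have hk := hu.isSqIntegrable N
    have hstep : ∫ ω in E, sys.runningCost (sys.state w s ξ u N ω) (u N ω) ∂μ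
        + ∫ ω in E, sys.expectedValue P (sys.state w s ξ u N ω) (u N ω) ∂μ
        = ∫ ω in E, sys.state w s ξ u N ω ⬝ᵥ P *ᵥ sys.state w s ξ u N ω ∂μ
          + ∫ ω in E, sys.excessCost P (sys.state w s ξ u N ω) (u N ω) ∂μ := by
      rw [← integral_add (hx.integrable_runningCost hk).integrableOn
        (hx.integrable_expectedValue hk P).integrableOn,
        ← integral_add (hx.integrable_dotProduct_mulVec P hx).integrableOn
          (hx.integrable_excessCost hk P).integrableOn]
      simp only [runningCost_add_expectedValue h hP, ← (solvesSARE_iff sys).1 hS]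
    rw [hu.setIntegral_state_succ hw (isSymm_of_posDef hP) hE, Finset.sum_range_succ,
      Finset.sum_range_succ]
    linarith

/-- The terminal value of an admissible control vanishes. -/
theorem IsAdmissible.tendsto_setIntegral_state [IsFiniteMeasure μ]
    (hw : IsGaussianNoise μ ℱ w sys.σ) (hu : sys.IsAdmissible μ ℱ w s ξ u)
    {P : Matrix (Fin n) (Fin n) ℝ} (hP : P.PosDef) (E : Set Ω) :
    Tendsto (fun N => ENNReal.ofReal
      (∫ ω in E, sys.state w s ξ u N ω ⬝ᵥ P *ᵥ sys.state w s ξ u N ω ∂μ)) atTop (𝓝 0) := by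
  obtain ⟨c, hc⟩ := exists_abs_dotProduct_mulVec_le P
  have hlim := ENNReal.Tendsto.const_mul (a := ENNReal.ofReal c) hu.stabilizing
    (Or.inr ENNReal.ofReal_ne_top)
  rw [mul_zero] at hlim
  refine tendsto_of_tendsto_of_tendsto_of_le_of_le tendsto_const_nhds hlim (fun N => zero_le)
    fun N => ?_
  have hx := hu.isSqIntegrable_state hw N
  have hint := hx.integrable_dotProduct_mulVec P hx
  rw [ofReal_integral_eq_lintegral_ofReal hint.integrableOn
    (ae_of_all _ fun ω => dotProduct_mulVec_nonneg hP _),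
    ← lintegral_const_mul' _ _ ENNReal.ofReal_ne_top]
  refine (setLIntegral_le_lintegral _ _).trans (lintegral_mono fun ω => ?_)
  dsimp only
  rw [← ENNReal.ofReal_mul' (by simpa using dotProduct_star_self_nonneg (sys.state w s ξ u N ω))]
  exact ENNReal.ofReal_le_ofReal ((le_abs_self _).trans (hc _))

/-- The infinite-horizon limit of the verification identity, taken in `[0, ∞]` so that neither
series has to be known finite. Arbitrary `E` in `ℱ s` is what identifies conditional expectations.
-/
theorem IsAdmissible.setLIntegral_cost [IsFiniteMeasure μ] (h : sys.WeightsPosDef)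
    (hw : IsGaussianNoise μ ℱ w sys.σ) (hu : sys.IsAdmissible μ ℱ w s ξ u)
    {P : Matrix (Fin n) (Fin n) ℝ} (hP : P.PosDef) (hS : sys.SolvesSARE P)
    {E : Set Ω} (hE : MeasurableSet[ℱ s] E) :
    ∫⁻ ω in E, ∑' k, ENNReal.ofReal (sys.runningCost (sys.state w s ξ u k ω) (u k ω)) ∂μ
      = ∫⁻ ω in E, (ENNReal.ofReal (ξ ⬝ᵥ P *ᵥ ξ)
        + ∑' k, ENNReal.ofReal (sys.excessCost P (sys.state w s ξ u k ω) (u k ω))) ∂μ := by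
  have hr := fun k => (hu.isSqIntegrable_state hw k).integrable_runningCost (sys := sys)
    (hu.isSqIntegrable k)
  have he := fun k => (hu.isSqIntegrable_state hw k).integrable_excessCost (sys := sys)
    (hu.isSqIntegrable k) P
  rw [lintegral_add_left measurable_const,
    lintegral_tsum fun k => (hr k).aemeasurable.ennreal_ofReal.restrict,
    lintegral_tsum fun k => (he k).aemeasurable.ennreal_ofReal.restrict, setLIntegral_const]
  have hr' := fun k => ofReal_integral_eq_lintegral_ofReal (hr k).integrableOn
    (ae_of_all (μ.restrict E) fun ω => runningCost_nonneg h (sys.state w s ξ u k ω) (u k ω))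
  have he' := fun k => ofReal_integral_eq_lintegral_ofReal (he k).integrableOn
    (ae_of_all (μ.restrict E) fun ω => excessCost_nonneg h hP (sys.state w s ξ u k ω) (u k ω))
  simp only [← hr', ← he']
  have hrn : ∀ k, 0 ≤ ∫ ω in E, sys.runningCost (sys.state w s ξ u k ω) (u k ω) ∂μ :=
    fun k => integral_nonneg fun ω => runningCost_nonneg h _ _
  have hen : ∀ k, 0 ≤ ∫ ω in E, sys.excessCost P (sys.state w s ξ u k ω) (u k ω) ∂μ :=
    fun k => integral_nonneg fun ω => excessCost_nonneg h hP _ _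
  -- The terminal term stays on the left: subtraction in `[0, ∞]` is truncated.
  have hfin : ∀ N : ℕ, (∑ k ∈ Finset.range N,
        ENNReal.ofReal (∫ ω in E, sys.runningCost (sys.state w s ξ u k ω) (u k ω) ∂μ))
        + ENNReal.ofReal (∫ ω in E, sys.state w s ξ u N ω ⬝ᵥ P *ᵥ sys.state w s ξ u N ω ∂μ)
      = ENNReal.ofReal (ξ ⬝ᵥ P *ᵥ ξ) * μ E + ∑ k ∈ Finset.range N,
        ENNReal.ofReal (∫ ω in E, sys.excessCost P (sys.state w s ξ u k ω) (u k ω) ∂μ) :=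
    fun N => by
      have hc : ENNReal.ofReal (ξ ⬝ᵥ P *ᵥ ξ) * μ E
          = ENNReal.ofReal (μ.real E * (ξ ⬝ᵥ P *ᵥ ξ)) := by
        rw [mul_comm, ENNReal.ofReal_mul measureReal_nonneg, ofReal_measureReal]
      rw [hc, ← ENNReal.ofReal_sum_of_nonneg fun k _ => hrn k,
        ← ENNReal.ofReal_sum_of_nonneg fun k _ => hen k,
        ← ENNReal.ofReal_add (Finset.sum_nonneg fun k _ => hrn k)
          (integral_nonneg fun ω => dotProduct_mulVec_nonneg hP _),
        ← ENNReal.ofReal_add (mul_nonneg measureReal_nonneg (dotProduct_mulVec_nonneg hP _))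
          (Finset.sum_nonneg fun k _ => hen k),
        hu.sum_setIntegral_runningCost h hw hP hS hE N]
  have hlim := ((ENNReal.tendsto_nat_tsum fun k => ENNReal.ofReal
    (∫ ω in E, sys.runningCost (sys.state w s ξ u k ω) (u k ω) ∂μ)).add
      (hu.tendsto_setIntegral_state hw hP E))
  simp only [hfin, add_zero] at hlim
  exact tendsto_nhds_unique hlim (tendsto_const_nhds.add (ENNReal.tendsto_nat_tsum _))

/-- The cost of an admissible control is the optimal value plus its conditional excess cost. -/
theorem IsAdmissible.cost_ae_eq [IsFiniteMeasure μ] (h : sys.WeightsPosDef)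
    (hw : IsGaussianNoise μ ℱ w sys.σ) (hu : sys.IsAdmissible μ ℱ w s ξ u)
    {P : Matrix (Fin n) (Fin n) ℝ} (hP : P.PosDef) (hS : sys.SolvesSARE P) :
    sys.cost μ ℱ w s ξ u =ᵐ[μ] condLExp (ℱ s) μ fun ω => ENNReal.ofReal (ξ ⬝ᵥ P *ᵥ ξ)
      + ∑' k, ENNReal.ofReal (sys.excessCost P (sys.state w s ξ u k ω) (u k ω)) :=
  ae_eq_condLExp (ℱ.le s) μ _ (measurable_condLExp _ _ _) fun E hE => by
    rw [cost, setLIntegral_condLExp (ℱ.le s) _ _ hE, hu.setLIntegral_cost h hw hP hS hE]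

theorem IsAdmissible.le_cost [IsFiniteMeasure μ] (h : sys.WeightsPosDef)
    (hw : IsGaussianNoise μ ℱ w sys.σ) (hu : sys.IsAdmissible μ ℱ w s ξ u)
    {P : Matrix (Fin n) (Fin n) ℝ} (hP : P.PosDef) (hS : sys.SolvesSARE P) :
    (fun _ => ENNReal.ofReal (ξ ⬝ᵥ P *ᵥ ξ)) ≤ᵐ[μ] sys.cost μ ℱ w s ξ u := by
  refine EventuallyLE.trans_eq ?_ (hu.cost_ae_eq h hw hP hS).symm
  rw [← condLExp_const (ℱ.le s) μ (ENNReal.ofReal (ξ ⬝ᵥ P *ᵥ ξ))]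
  exact condLExp_mono (ae_of_all _ fun ω => le_self_add)

theorem SolvesSARE.cost_feedback [IsProbabilityMeasure μ] (h : sys.WeightsPosDef)
    (hw : IsGaussianNoise μ ℱ w sys.σ) {P : Matrix (Fin n) (Fin n) ℝ} (hP : P.PosDef)
    (hS : sys.SolvesSARE P) (s : ℕ) (ξ : Fin n → ℝ) :
    sys.cost μ ℱ w s ξ (sys.feedback w (sys.gain P) s ξ)
      =ᵐ[μ] fun _ => ENNReal.ofReal (ξ ⬝ᵥ P *ᵥ ξ) := by
  have hadm := (hS.isStabilizingGain h hP).isAdmissible hw s ξ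
  refine (hadm.cost_ae_eq h hw hP hS).trans ?_
  simp only [state_feedback, feedback, excessCost_gain, ENNReal.ofReal_zero, tsum_zero, add_zero]
  rw [condLExp_const (ℱ.le s)]

theorem SolvesSARE.isOptimal [IsProbabilityMeasure μ] (h : sys.WeightsPosDef)
    (hw : IsGaussianNoise μ ℱ w sys.σ) {P : Matrix (Fin n) (Fin n) ℝ} (hP : P.PosDef)
    (hS : sys.SolvesSARE P) (s : ℕ) (ξ : Fin n → ℝ) :
    sys.IsOptimal μ ℱ w s ξ (sys.feedback w (sys.gain P) s ξ) :=
  ⟨(hS.isStabilizingGain h hP).isAdmissible hw s ξ, fun _ hv =>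
    (hS.cost_feedback h hw hP s ξ).trans_le (hv.le_cost h hw hP hS)⟩

/-- The control attaining zero excess cost at every time is the feedback control. -/
theorem eq_feedback_of_excessCost_eq_zero (h : sys.WeightsPosDef)
    {P : Matrix (Fin n) (Fin n) ℝ} (hP : P.PosDef) {ω : Ω}
    (hu : ∀ k, sys.excessCost P (sys.state w s ξ u k ω) (u k ω) = 0) (k : ℕ) :
    u k ω = sys.feedback w (sys.gain P) s ξ k ω := by
  have hu' : ∀ k, u k ω = sys.gain P *ᵥ sys.state w s ξ u k ω := fun k =>
    sub_eq_zero.1 (eq_zero_of_dotProduct_mulVec (controlHessian_posDef h hP) (hu k))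
  have hstate : ∀ k, sys.state w s ξ u k ω
      = sys.state w s ξ (sys.feedback w (sys.gain P) s ξ) k ω := fun k => by
    induction k with
    | zero => rfl
    | succ k ih => rw [state, state, hu' k, ih, feedback, state_feedback]
  rw [hu', hstate, state_feedback, feedback]

/-- Comparison with the feedback control bounds the expected cost by the finite number `ξ' P ξ`,
which cancels and leaves zero expected excess. -/
theorem IsOptimal.ae_eq_feedback [IsProbabilityMeasure μ] (h : sys.WeightsPosDef)
    (hw : IsGaussianNoise μ ℱ w sys.σ) {P : Matrix (Fin n) (Fin n) ℝ} (hP : P.PosDef)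
    (hS : sys.SolvesSARE P) (hu : sys.IsOptimal μ ℱ w s ξ u) (k : ℕ) :
    u k =ᵐ[μ] sys.feedback w (sys.gain P) s ξ k := by
  have he := fun k => (hu.1.isSqIntegrable_state hw k).integrable_excessCost (sys := sys)
    (hu.1.isSqIntegrable k) P
  have hle := (hu.2 _ (hS.isOptimal h hw hP s ξ).1).trans_eq (hS.cost_feedback h hw hP s ξ)
  have hint := lintegral_mono_ae hle
  rw [cost, lintegral_condLExp (ℱ.le s), ← setLIntegral_univ,
    hu.1.setLIntegral_cost h hw hP hS MeasurableSet.univ, setLIntegral_univ,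
    lintegral_add_left measurable_const, lintegral_const, measure_univ, mul_one] at hint
  have hzero : ∫⁻ ω, ∑' k, ENNReal.ofReal
      (sys.excessCost P (sys.state w s ξ u k ω) (u k ω)) ∂μ = 0 :=
    le_antisymm (ENNReal.le_of_add_le_add_left ENNReal.ofReal_ne_top
      (hint.trans_eq (add_zero _).symm)) zero_le
  rw [lintegral_eq_zero_iff' (AEMeasurable.tsum fun k =>
    (he k).aemeasurable.ennreal_ofReal)] at hzero
  -- One null set serves all times, as required because each state depends on all earlier controls.
  filter_upwards [hzero] with ω hω
  refine eq_feedback_of_excessCost_eq_zero h hP (fun j => ?_) k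
  exact le_antisymm (ENNReal.ofReal_eq_zero.1 (ENNReal.tsum_eq_zero.1 hω j))
    (excessCost_nonneg h hP _ _)

theorem exists_isPolicyIteration [IsProbabilityMeasure μ] (h : sys.WeightsPosDef)
    (hw : IsGaussianNoise μ ℱ w sys.σ) {K₀ : Matrix (Fin m) (Fin n) ℝ}
    (hK₀ : sys.IsStabilizingGain K₀) (s l : ℕ) :
    ∃ P K, sys.IsPolicyIteration μ ℱ w s l K₀ P K := by
  -- The default `0` off the stabilizing gains makes evaluation a total function that can be
  -- iterated before stability is known.
  have hex : ∀ K, ∃ P, sys.IsStabilizingGain K → sys.IsValue K P := fun K => by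
    by_cases hK : sys.IsStabilizingGain K
    · exact (hK.exists_isValue h).imp fun _ hP _ => hP
    · exact ⟨0, fun hK' => absurd hK' hK⟩
  choose V hV using hex
  let K : ℕ → Matrix (Fin m) (Fin n) ℝ := fun i => (fun K => sys.gain (V K))^[i] K₀
  have hsucc : ∀ i, K (i + 1) = sys.gain (V (K i)) := fun i =>
    Function.iterate_succ_apply' _ _ _
  have hK : ∀ i, sys.IsStabilizingGain (K i) := fun i => by
    induction i with
    | zero => exact hK₀
    | succ i ih => rw [hsucc]; exact (hV _ ih).isStabilizingGain_gain h ih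
  -- Truncated subtraction gives `P (i + 1) = V (K i)`; the value at `0` is irrelevant.
  exact ⟨fun i => V (K (i - 1)), K, rfl, fun i => (hV _ (hK i)).1,
    fun i => ((hK i).policyEvaluation_iff h hw (hV _ (hK i)).1).2 (hV _ (hK i)), hsucc⟩

/-- Stability has to be carried through the induction: it identifies `P (i + 1)` as a value, and
that value makes the next gain stabilizing. -/
theorem IsPolicyIteration.isStabilizingGain_and_isValue [IsProbabilityMeasure μ]
    (h : sys.WeightsPosDef) (hw : IsGaussianNoise μ ℱ w sys.σ) {K₀ : Matrix (Fin m) (Fin n) ℝ}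
    (hK₀ : sys.IsStabilizingGain K₀) {l : ℕ} {P : ℕ → Matrix (Fin n) (Fin n) ℝ}
    {K : ℕ → Matrix (Fin m) (Fin n) ℝ} (hPK : sys.IsPolicyIteration μ ℱ w s l K₀ P K) (i : ℕ) :
    sys.IsStabilizingGain (K i) ∧ sys.IsValue (K i) (P (i + 1)) := by
  have hval : ∀ i, sys.IsStabilizingGain (K i) → sys.IsValue (K i) (P (i + 1)) := fun i hi =>
    (hi.policyEvaluation_iff h hw (hPK.symm i)).1 (hPK.evaluation i)
  suffices hst : sys.IsStabilizingGain (K i) from ⟨hst, hval i hst⟩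
  induction i with
  | zero => rwa [hPK.init]
  | succ i ih => rw [hPK.improvement]; exact (hval i ih).isStabilizingGain_gain h ih

end Data

end StochLQ

theorem theorem2 {n m : ℕ} (sys : StochLQ.Data n m) (hsys : sys.WeightsPosDef)
    {Ω : Type*} {mΩ : MeasurableSpace Ω} (μ : Measure Ω) [IsProbabilityMeasure μ]
    (ℱ : Filtration ℕ mΩ) (w : ℕ → Ω → ℝ) (hw : StochLQ.IsGaussianNoise μ ℱ w sys.σ)
    (K₀ : Matrix (Fin m) (Fin n) ℝ) (hK₀ : K₀ ∈ sys.stabilizers μ w) (s l : ℕ) :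
    -- the algorithm can be run
    (∃ P K, sys.IsPolicyIteration μ ℱ w s l K₀ P K) ∧
    -- every stabilizing feedback law is an admissible control
    (∀ K ∈ sys.stabilizers μ w, ∀ (t : ℕ) (ξ : Fin n → ℝ),
      sys.IsAdmissible μ ℱ w t ξ (sys.feedback w K t ξ)) ∧
    -- convergence of every run
    ∀ P K, sys.IsPolicyIteration μ ℱ w s l K₀ P K →
      (∀ i, 1 ≤ i → (P i).PosDef) ∧
      (∀ i, 1 ≤ i → (P i - P (i + 1)).PosSemidef) ∧
      ∃ Pinf : Matrix (Fin n) (Fin n) ℝ,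
        Tendsto P atTop (𝓝 Pinf) ∧
        Tendsto K atTop (𝓝 (sys.gain Pinf)) ∧
        Pinf.PosDef ∧
        sys.SolvesSARE Pinf ∧
        (∀ P' : Matrix (Fin n) (Fin n) ℝ, P'.PosDef → sys.SolvesSARE P' → P' = Pinf) ∧
        sys.gain Pinf ∈ sys.stabilizers μ w ∧
        ∀ (t : ℕ) (ξ : Fin n → ℝ),
          sys.IsOptimal μ ℱ w t ξ (sys.feedback w (sys.gain Pinf) t ξ) ∧
          ∀ v, sys.IsOptimal μ ℱ w t ξ v →
            ∀ k, v k =ᵐ[μ] sys.feedback w (sys.gain Pinf) t ξ k := by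
  have hK₀' := (StochLQ.Data.mem_stabilizers_iff hw).1 hK₀
  refine ⟨StochLQ.Data.exists_isPolicyIteration hsys hw hK₀' s l, fun K hK t ξ =>
    ((StochLQ.Data.mem_stabilizers_iff hw).1 hK).isAdmissible hw t ξ, fun P K hPK => ?_⟩
  have hrun := hPK.isStabilizingGain_and_isValue hsys hw hK₀'
  refine ⟨fun i hi => ?_, fun i hi => ?_, ?_⟩
  · obtain ⟨j, rfl⟩ := Nat.exists_eq_add_of_le' hi
    exact (hrun j).2.posDef hsys (hrun j).1
  · obtain ⟨j, rfl⟩ := Nat.exists_eq_add_of_le' hi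
    refine StochLQ.posSemidef_of_isSymm ((hrun j).2.1.sub (hrun (j + 1)).2.1) fun x => ?_
    have hle := (hrun j).2.improvement hsys (hrun j).1
      (by simpa only [hPK.improvement] using (hrun (j + 1)).2) x
    rw [sub_mulVec, dotProduct_sub]
    linarith
  · obtain ⟨Y, hPY, hKY, hY, hS⟩ := StochLQ.Data.exists_tendsto_of_isValue hsys
      (fun i => (hrun i).1) (fun i => (hrun i).2) hPK.improvement
    exact ⟨Y, hPY, hKY, hY, hS, fun P' hP' hS' => hS'.unique hsys hP' hY hS,
      (StochLQ.Data.mem_stabilizers_iff hw).2 (hS.isStabilizingGain hsys hY),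
      fun t ξ => ⟨hS.isOptimal hsys hw hY t ξ, fun v hv k => hv.ae_eq_feedback hsys hw hY hS k⟩⟩
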